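/- A relation algebra is an algebra $\langle A,\vee,\neg,\circ,{}^{\smallsmile},t\rangle$ such that for all $a,b,c\in A$: $a\vee b=b\vee a$; $a\vee(b\vee c)=(a\vee b)\vee c$; $\neg(\neg a\vee b)\vee\neg(\neg a\vee\neg b)=a$; $a\circ(b\circ c)=(a\circ b)\circ c$; $a\circ t=a$; $a^{\smallsmile\smallsmile}=a$; $(a\circ b)^{\smallsmile}=b^{\smallsmile}\circ a^{\smallsmile}$; $(a\vee b)\circ c=(a\circ c)\vee(b\circ c)$; $(a\vee b)^{\smallsmile}=a^{\smallsmile}\vee b^{\smallsmile}$; $(a^{\smallsmile}\circ\neg(a\circ b))\vee\neg b=\neg b$. It is *abelian* if $a\circ b=b\circ a$ for all $a,b$, *symmetric* if $a^{\smallsmile}=a$ for all $a$, and *dense* if $a\le a\circ a$ (that is, $a\vee(a\circ a)=a\circ a$) for all $a$. The dense symmetric relation algebras are also called Boolean monoids. For a class $\mathsf V$ of such algebras, regarded as a category with all homomorphisms (maps preserving $\vee,\neg,\circ,{}^{\smallsmile},t$) between its members, a homomorphism $f:A\to B$ with $A,B\in\mathsf V$ is an epimorphism if for every $C\in\mathsf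 V$ and all homomorphisms $g,h:B\to C$, $g\circ f=h\circ f$ implies $g=h$. The class $\mathsf V$ has the property ES if every epimorphism in $\mathsf V$ is surjective. For a modular lattice $L$ with least element $0$, the lattice complex algebra of $L$ is the power set of $L$ with union, complement, $X\circ Y=\{z\in L: x\vee y=x\vee z=y\vee z\text{ for some }x\in X,\ y\in Y\}$, $X^{\smallsmile}=X$ and $t=\{0\}$. **Corollary.** Let $\mathsf V$ be the variety of abelian relation algebras, the variety of symmetric relation algebras, or the variety of dense symmetric relation algebras (Boolean monoids). Then ES fails for $\mathsf V$: there are $A,B\in\mathsf V$ and an epimorphism $A\to B$ in $\mathsf V$ that is not surjective. Moreover, $\mathsf V$ contains the lattice complex algebra of every modular lattice with least element, it contains every algebra isomorphic to a subalgebra of such a lattice complex algebra, and every member of $\mathsf V$ is an abelian relation algebra. -/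

import Mathlib

universe u

/-- An algebra `⟨A, ∨, ¬, ∘, ˘, t⟩` of the similarity type of relation algebras (no laws yet). -/
structure RelTypeAlg where
  carrier : Type u
  join : carrier → carrier → carrier
  neg : carrier → carrier
  comp : carrier → carrier → carrier
  conv : carrier → carrier
  t : carrier

namespace RelTypeAlg

/-- The laws of a relation algebra. The first three are Huntington's axioms for Boolean algebras. -/
structure IsRelationAlgebra (A : RelTypeAlg.{u}) : Prop where
  join_comm : ∀ a b, A.join a b = A.join b a
  join_assoc : ∀ a b c, A.join a (A.join b c) = A.join (A.join a b) c
  huntington : ∀ a b,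
    A.join (A.neg (A.join (A.neg a) b)) (A.neg (A.join (A.neg a) (A.neg b))) = a
  comp_assoc : ∀ a b c, A.comp a (A.comp b c) = A.comp (A.comp a b) c
  comp_t : ∀ a, A.comp a A.t = a
  conv_conv : ∀ a, A.conv (A.conv a) = a
  conv_comp : ∀ a b, A.conv (A.comp a b) = A.comp (A.conv b) (A.conv a)
  join_comp : ∀ a b c, A.comp (A.join a b) c = A.join (A.comp a c) (A.comp b c)
  conv_join : ∀ a b, A.conv (A.join a b) = A.join (A.conv a) (A.conv b)
  tarski : ∀ a b,
    A.join (A.comp (A.conv a) (A.neg (A.comp a b))) (A.neg b) = A.neg b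

/-- The Boolean order: `a ≤ b` iff `a ∨ b = b`. -/
def le (A : RelTypeAlg.{u}) (a b : A.carrier) : Prop := A.join a b = b

def IsAbelian (A : RelTypeAlg.{u}) : Prop := ∀ a b, A.comp a b = A.comp b a

def IsSymmetric (A : RelTypeAlg.{u}) : Prop := ∀ a, A.conv a = a

def IsDense (A : RelTypeAlg.{u}) : Prop := ∀ a, A.le a (A.comp a a)

/-- Homomorphisms preserve all the operations `∨, ¬, ∘, ˘, t`. -/
structure Hom (A B : RelTypeAlg.{u}) where
  toFun : A.carrier → B.carrier
  map_join : ∀ a b, toFun (A.join a b) = B.join (toFun a) (toFun b)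
  map_neg : ∀ a, toFun (A.neg a) = B.neg (toFun a)
  map_comp : ∀ a b, toFun (A.comp a b) = B.comp (toFun a) (toFun b)
  map_conv : ∀ a, toFun (A.conv a) = B.conv (toFun a)
  map_t : toFun A.t = B.t

/-- Composition `g ∘ f` of homomorphisms. -/
def Hom.after {A B C : RelTypeAlg.{u}} (g : Hom B C) (f : Hom A B) : Hom A C where
  toFun := fun a => g.toFun (f.toFun a)
  map_join a b := by rw [f.map_join, g.map_join]
  map_neg a := by rw [f.map_neg, g.map_neg]
  map_comp a b := by rw [f.map_comp, g.map_comp]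
  map_conv a := by rw [f.map_conv, g.map_conv]
  map_t := by rw [f.map_t, g.map_t]

/-- `f : A → B` is an epimorphism in the category whose objects are the members of the class `V`
and whose morphisms are all homomorphisms between them. -/
def Hom.IsEpi (V : Set RelTypeAlg.{u}) {A B : RelTypeAlg.{u}} (f : Hom A B) : Prop :=
  ∀ C ∈ V, ∀ g h : Hom B C, g.after f = h.after f → g = h

/-- The property ES for a class of algebras: all epimorphisms are surjective. -/
def ES (V : Set RelTypeAlg.{u}) : Prop :=
  ∀ A ∈ V, ∀ B ∈ V, ∀ f : Hom A B, f.IsEpi V → Function.Surjective f.toFun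

/-- The variety of abelian relation algebras. -/
def abelianRA : Set RelTypeAlg.{u} := {A | A.IsRelationAlgebra ∧ A.IsAbelian}

/-- The variety of symmetric relation algebras. -/
def symmetricRA : Set RelTypeAlg.{u} := {A | A.IsRelationAlgebra ∧ A.IsSymmetric}

/-- The variety of dense symmetric relation algebras, i.e. of Boolean monoids. -/
def denseSymmetricRA : Set RelTypeAlg.{u} :=
  {A | A.IsRelationAlgebra ∧ A.IsDense ∧ A.IsSymmetric}

/-- The complex algebra of a set `S` with a ternary relation `R` and a point `e`: the Boolean
algebra of all subsets of `S`, with `X ∘ Y = {z | R x y z for some x ∈ X, y ∈ Y}`, with the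
identity map as converse, and with `t = {e}`. -/
def complexAlg (S : Type u) (R : S → S → S → Prop) (e : S) : RelTypeAlg.{u} where
  carrier := Set S
  join X Y := X ∪ Y
  neg X := Xᶜ
  comp X Y := {z | ∃ x ∈ X, ∃ y ∈ Y, R x y z}
  conv X := X
  t := {e}

/-- The lattice complex algebra of a lattice `L` with least element `⊥`, which uses the relation
`R a b c ↔ a ∨ b = a ∨ c = b ∨ c`. -/
def latticeComplexAlg (L : Type u) [Lattice L] [OrderBot L] : RelTypeAlg.{u} :=
  complexAlg L (fun a b c => a ⊔ b = a ⊔ c ∧ a ⊔ c = b ⊔ c) ⊥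

/-- The class of all algebras that are (isomorphic to) a subalgebra of the lattice complex algebra
of a modular lattice with least element. -/
def latticeRA : Set RelTypeAlg.{u} :=
  {A | ∃ (L : Type u) (_ : Lattice L) (_ : OrderBot L) (_ : IsModularLattice L)
    (f : Hom A (latticeComplexAlg L)), Function.Injective f.toFun}

end RelTypeAlg

/-!
# Epimorphisms of relation algebras

All three varieties lie between the dense symmetric and the abelian relation algebras, so it suffices
to find a dense symmetric algebra `B` with a proper subalgebra `A` such that the inclusion is an
epimorphism in the class of abelian relation algebras, and to show that complex algebras of modular
lattices are dense and symmetric. For the latter, associativity is Pasch's axiom: the modular law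
makes `(a ⊔ d) ⊓ (b ⊔ c)` the required intermediate element.

The algebra `B` consists of the symmetric subsets of the group `W × F`, where `F` is the plane over
the field with three elements and `W` is a finite group of exponent three. Its atoms are `{0}` and
the sets `{v, -v}`, the points of a projective geometry all of whose lines have four points. Given
subgroups `N e` of `W` for `e` in `F` with `N (e + e') ≤ N e ⊔ N e'`, the sets whose fibre over each
`e` is a union of cosets of `N e` form the subalgebra `A`. A collineation fixing all members of `A`
has the form `(w, e) ↦ (w + φ e, e)` with `φ` linear and `φ e ∈ N e`. Here `W` is the plane over the
field with nine elements, and the `N e` are four lines whose cross ratio is not in the prime field;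
then `φ = 0`, although the single fibres of `A` are not trivial (`isRigidFamily_lineFamily`).

It remains to see that two homomorphisms `g` and `h` from `B` to an arbitrary abelian relation
algebra `C` that agree on `A` differ by such a collineation. One may restrict `C` to its symmetric
elements (`Hom.isEpi_abelianRA_of_symmetricRA`). The main tool is
`SymmetricRelAlg.mul_sdiff_eq_bot`: the image of a point of `B` is minimal among the `p ≠ ⊥` for
which `1 ⊔ p` is an equivalence element, apart from the possible decomposability of `C`. Hence the
meet of the `h`-image of one point with the `g`-image of another one is all or nothing, and in
`map_point_one_zero_le` the rigidity of the family shows that `h` and `g` agree at `(0, (1, 0))`.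
This point generates `B` together with `A` (`point_mem_of_point_one_zero_mem`).
-/

open scoped Pointwise

/-! ### Symmetric relation algebras as Boolean algebras with a multiplication -/

/-- A symmetric relation algebra, presented as a Boolean algebra with a commutative monoid
structure: `*` is the relative product, `1` the identity element, and converse is the identity
map, so that Tarski's law becomes the symmetric form of the Peircean law. -/
class SymmetricRelAlg (α : Type*) extends BooleanAlgebra α, CommMonoid α where
  sup_mul (a b c : α) : (a ⊔ b) * c = a * c ⊔ b * c
  peirce (a b c : α) : Disjoint (a * b) c → Disjoint (a * c) b

namespace SymmetricRelAlg

variable {α : Type*} [SymmetricRelAlg α] {a b c d e p q x y z : α}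

theorem mul_sup (a b c : α) : a * (b ⊔ c) = a * b ⊔ a * c := by
  rw [mul_comm, sup_mul, mul_comm b, mul_comm c]

theorem mul_mono (hab : a ≤ b) (hcd : c ≤ d) : a * c ≤ b * d :=
  calc a * c ≤ b * c := by rw [← sup_eq_right.mpr hab, sup_mul]; exact le_sup_left
    _ ≤ b * d := by rw [← sup_eq_right.mpr hcd, mul_sup]; exact le_sup_left

theorem mul_bot (a : α) : a * ⊥ = ⊥ := by
  simpa using peirce a ⊤ ⊥ disjoint_bot_right

theorem bot_mul (a : α) : ⊥ * a = ⊥ := by rw [mul_comm, mul_bot]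

theorem disjoint_mul_comm : Disjoint (a * b) c ↔ Disjoint b (a * c) :=
  ⟨fun h => (peirce _ _ _ h).symm, fun h => peirce _ _ _ h.symm⟩

/-- An element with an inverse up to inclusion is cancellable from a zero product. -/
theorem eq_bot_of_mul_eq_bot (hb : 1 ≤ b * c) (h : a * b = ⊥) : a = ⊥ := by
  have : a ≤ a * b * c := by
    rw [mul_assoc]
    simpa using mul_mono (le_refl a) hb
  rwa [h, bot_mul, le_bot_iff] at this

/-- If `p ≤ e` splits a point `e` of the line `{e, x, y, z}`, then the translates of `p` and of
`e \ p` by the point `y` are disjoint. -/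
theorem disjoint_mul_mul_sdiff (hyy : y * y ≤ 1 ⊔ y) (hey : e * y = x ⊔ z)
    (hex : Disjoint e x) (hez : Disjoint e z) (hp : p ≤ e) :
    Disjoint (p * y) ((e \ p) * y) := by
  rw [mul_comm (e \ p), ← disjoint_mul_comm, disjoint_comm, disjoint_comm]
  have h : y * (p * y) ≤ p ⊔ (x ⊔ z) :=
    calc y * (p * y) = p * (y * y) := by ac_rfl
      _ ≤ p * (1 ⊔ y) := mul_mono le_rfl hyy
      _ = p ⊔ p * y := by rw [mul_sup, mul_one]
      _ ≤ p ⊔ (x ⊔ z) := sup_le_sup_left (hey ▸ mul_mono hp le_rfl) _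
  refine Disjoint.mono_left h ?_
  rw [disjoint_sup_left, disjoint_sup_left]
  exact ⟨disjoint_sdiff_self_right, (hex.mono_left sdiff_le).symm, (hez.mono_left sdiff_le).symm⟩

/-- Minimality of points: let `{e, x, y, z}` behave like a line with exactly four points. If
`p ≤ e` and `1 ⊔ p` is an equivalence element, then the product of `p` and `e \ p` vanishes; in
the simple case this means that `p` is `⊥` or `e`. The reason is that otherwise the point `x` would
be the union of two proper parts that are, together with `1`, closed under products, just as a
group would be a union of two proper subgroups. -/
theorem mul_sdiff_eq_bot (hx1 : 1 ≤ x * x) (hxx : x * x ≤ 1 ⊔ x) (hyy : y * y ≤ 1 ⊔ y)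
    (hzz : z * z ≤ 1 ⊔ z) (hex : e * x = y ⊔ z) (hey : e * y = x ⊔ z) (hez : e * z = x ⊔ y)
    (hxy : e ≤ x * y) (hxz : e ≤ x * z) (dx1 : Disjoint x 1) (dex : Disjoint e x)
    (dey : Disjoint e y) (dez : Disjoint e z) (dxy : Disjoint x y) (dxz : Disjoint x z)
    (hp : p ≤ e) (hpp : p * p ≤ 1 ⊔ p) : p * (e \ p) = ⊥ := by
  obtain ⟨q, hq⟩ : ∃ q, q = e \ p := ⟨_, rfl⟩
  have hqe : q ≤ e := hq ▸ sdiff_le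
  have hpq : p ⊔ q = e := by rw [hq, sup_sdiff_cancel_right hp]
  have dy : Disjoint (p * y) (q * y) := hq ▸ disjoint_mul_mul_sdiff hyy hey dex dez hp
  have dz : Disjoint (p * z) (q * z) := hq ▸ disjoint_mul_mul_sdiff hzz hez dex dey hp
  rw [← hq]
  -- Split `x` according to the translates of `p` and `q` by `y` and by `z`.
  obtain ⟨m, hm⟩ : ∃ m, m = x ⊓ (p * y) ⊓ (q * z) := ⟨_, rfl⟩
  obtain ⟨n, hn⟩ : ∃ n, n = x ⊓ (p * z) ⊓ (q * y) := ⟨_, rfl⟩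
  obtain ⟨k, hk⟩ : ∃ k, k = x ⊓ (p * y) ⊓ (p * z) := ⟨_, rfl⟩
  obtain ⟨r, hr⟩ : ∃ r, r = x ⊓ (q * y) ⊓ (q * z) := ⟨_, rfl⟩
  have mx : m ≤ x := hm ▸ inf_le_left.trans inf_le_left
  have mpy : m ≤ p * y := hm ▸ inf_le_left.trans inf_le_right
  have mqz : m ≤ q * z := hm ▸ inf_le_right
  have nx : n ≤ x := hn ▸ inf_le_left.trans inf_le_left
  have npz : n ≤ p * z := hn ▸ inf_le_left.trans inf_le_right
  have nqy : n ≤ q * y := hn ▸ inf_le_right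
  have kx : k ≤ x := hk ▸ inf_le_left.trans inf_le_left
  have kpy : k ≤ p * y := hk ▸ inf_le_left.trans inf_le_right
  have kpz : k ≤ p * z := hk ▸ inf_le_right
  have rx : r ≤ x := hr ▸ inf_le_left.trans inf_le_left
  have rqy : r ≤ q * y := hr ▸ inf_le_left.trans inf_le_right
  have rqz : r ≤ q * z := hr ▸ inf_le_right
  have hsplit : x = (m ⊔ k) ⊔ (n ⊔ r) := by
    have h1 : x ≤ p * y ⊔ q * y := by rw [← sup_mul, hpq, hey]; exact le_sup_left
    have h2 : x ≤ p * z ⊔ q * z := by rw [← sup_mul, hpq, hez]; exact le_sup_left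
    have e1 : m ⊔ k = x ⊓ (p * y) := by
      rw [hm, hk, ← inf_sup_left, sup_comm, inf_eq_left.mpr]
      exact inf_le_left.trans h2
    have e2 : n ⊔ r = x ⊓ (q * y) := by
      rw [hn, hr, inf_right_comm, ← inf_sup_left, inf_eq_left.mpr]
      exact inf_le_left.trans h2
    rw [e1, e2, ← inf_sup_left, inf_eq_left.mpr h1]
  have pr : p * r = ⊥ := by
    have h1 : p * r ≤ y ⊔ z := hex ▸ mul_mono hp rx
    have h2 : Disjoint (p * r) (y ⊔ z) := by
      rw [disjoint_sup_right, disjoint_mul_comm, disjoint_mul_comm]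
      exact ⟨(dy.mono_right rqy).symm, (dz.mono_right rqz).symm⟩
    exact h2.eq_bot_of_le h1
  have qk : q * k = ⊥ := by
    have h1 : q * k ≤ y ⊔ z := hex ▸ mul_mono hqe kx
    have h2 : Disjoint (q * k) (y ⊔ z) := by
      rw [disjoint_sup_right, disjoint_mul_comm, disjoint_mul_comm]
      exact ⟨dy.mono_left kpy, dz.mono_left kpz⟩
    exact h2.eq_bot_of_le h1
  -- `1 ⊔ p * w` is closed under products up to `p` and `w`, which are disjoint from `x`.
  have closed : ∀ w s t u, w * w ≤ 1 ⊔ w → Disjoint x w → s ≤ p * w → t ≤ p * w → u ≤ x →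
      Disjoint u (p * w) → Disjoint (s * t) u := by
    intro w s t u hw dxw hs ht hu du
    have h : s * t ≤ 1 ⊔ w ⊔ (p ⊔ p * w) :=
      calc s * t ≤ (p * w) * (p * w) := mul_mono hs ht
        _ = (p * p) * (w * w) := by ac_rfl
        _ ≤ (1 ⊔ p) * (1 ⊔ w) := mul_mono hpp hw
        _ = 1 ⊔ w ⊔ (p ⊔ p * w) := by rw [sup_mul, one_mul, mul_sup, mul_one]
    refine Disjoint.mono_left h ?_
    simp only [disjoint_sup_left]
    exact ⟨⟨(dx1.mono_left hu).symm, (dxw.mono_left hu).symm⟩,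
      (dex.mono hp hu), du.symm⟩
  have mn : m * n = ⊥ := by
    have h1 : m * n ≤ 1 ⊔ ((m ⊔ k) ⊔ (n ⊔ r)) := by
      rw [← hsplit]; exact (mul_mono mx nx).trans hxx
    have h2 : Disjoint (m * n) (1 ⊔ ((m ⊔ k) ⊔ (n ⊔ r))) := by
      simp only [disjoint_sup_right]
      refine ⟨?_, ⟨?_, ?_⟩, ?_, ?_⟩
      · rw [disjoint_mul_comm, mul_one]
        exact (dy.mono mpy nqy).symm
      · rw [disjoint_mul_comm, disjoint_comm]
        exact closed y m m n hyy dxy mpy mpy nx (dy.mono_right nqy).symm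
      · rw [disjoint_mul_comm, disjoint_comm]
        exact closed y m k n hyy dxy mpy kpy nx (dy.mono_right nqy).symm
      · rw [mul_comm, disjoint_mul_comm, disjoint_comm]
        exact closed z n n m hzz dxz npz npz mx (dz.mono_right mqz).symm
      · have : n * r = ⊥ := by
          rw [← le_bot_iff]
          calc n * r ≤ (p * z) * r := mul_mono npz le_rfl
            _ = z * (p * r) := by ac_rfl
            _ ≤ ⊥ := by rw [pr, mul_bot]
        rw [mul_comm, disjoint_mul_comm, this]
        exact disjoint_bot_right
    exact h2.eq_bot_of_le h1
  have vanish : ∀ d s t w, d * s = ⊥ → d * t = ⊥ → d * w = ⊥ → ∀ v, q ≤ (s ⊔ t ⊔ w) * v →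
      d * q = ⊥ := by
    intro d s t w hs ht hw v hv
    rw [← le_bot_iff]
    calc d * q ≤ d * ((s ⊔ t ⊔ w) * v) := mul_mono le_rfl hv
      _ = (d * s ⊔ d * t ⊔ d * w) * v := by rw [← mul_assoc, mul_sup, mul_sup]
      _ ≤ ⊥ := by simp [hs, ht, hw, bot_mul]
  have selfDisj : ∀ s, s * q * q = ⊥ → s * q = ⊥ := by
    intro s hs
    have h : Disjoint (q * (s * q)) s := by
      rw [mul_comm q, hs]; exact disjoint_bot_left
    have := disjoint_mul_comm.mp h
    rwa [mul_comm q, disjoint_self] at this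
  have kill : ∀ s, s * q * k = ⊥ := fun s => by rw [mul_assoc, qk, mul_bot]
  have killr : ∀ s, s * p * q * r = ⊥ := fun s => by
    rw [show s * p * q * r = s * q * (p * r) by ac_rfl, pr, mul_bot]
  have pqm : m * p * q = ⊥ := by
    apply selfDisj
    refine vanish _ n k r ?_ (kill _) (killr _) y ?_
    · rw [show m * p * q * n = (p * q) * (m * n) by ac_rfl, mn, mul_bot]
    · have h1 : q ≤ m * y ⊔ (n ⊔ k ⊔ r) * y := by
        rw [← sup_mul, show m ⊔ (n ⊔ k ⊔ r) = x by rw [hsplit]; ac_rfl]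
        exact hqe.trans hxy
      refine Disjoint.left_le_of_le_sup_left h1 ?_
      rw [mul_comm, disjoint_comm, disjoint_mul_comm, mul_comm]
      exact dy.mono_left mpy
  have pqn : n * p * q = ⊥ := by
    apply selfDisj
    refine vanish _ m k r ?_ (kill _) (killr _) z ?_
    · rw [show n * p * q * m = (p * q) * (m * n) by ac_rfl, mn, mul_bot]
    · have h1 : q ≤ n * z ⊔ (m ⊔ k ⊔ r) * z := by
        rw [← sup_mul, show n ⊔ (m ⊔ k ⊔ r) = x by rw [hsplit]; ac_rfl]
        exact hqe.trans hxz
      refine Disjoint.left_le_of_le_sup_left h1 ?_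
      rw [mul_comm, disjoint_comm, disjoint_mul_comm, mul_comm]
      exact dz.mono_left npz
  refine eq_bot_of_mul_eq_bot hx1 ?_
  rw [hsplit, mul_sup, mul_sup, mul_sup, kill]
  rw [show p * q * m = m * p * q by ac_rfl, pqm, show p * q * n = n * p * q by ac_rfl, pqn,
    show p * q * r = q * (p * r) by ac_rfl, pr, mul_bot]
  simp

end SymmetricRelAlg

namespace RelTypeAlg

variable {A B C : RelTypeAlg.{u}}

/-! ### The Boolean algebra given by Huntington's axioms -/

namespace IsRelationAlgebra

theorem join_neg_eq_neg_join (hA : A.IsRelationAlgebra) (a : A.carrier) :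
    A.join a (A.neg a) = A.join (A.neg a) (A.neg (A.neg a)) := by
  have := hA.join_comm
  have := hA.join_assoc
  have := hA.huntington a (A.neg (A.neg a))
  have := hA.huntington (A.neg a) (A.neg a)
  have := hA.huntington (A.neg a) (A.neg (A.neg a))
  have := hA.huntington (A.neg (A.neg a)) (A.neg a)
  grind

theorem neg_neg (hA : A.IsRelationAlgebra) (a : A.carrier) : A.neg (A.neg a) = a := by
  have h1 := hA.huntington a (A.neg (A.neg a))
  have h2 := hA.huntington (A.neg (A.neg a)) (A.neg a)
  have h3 := hA.join_neg_eq_neg_join (A.neg a)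
  rw [hA.join_comm _ (A.neg (A.neg a)), ← h3, hA.join_comm _ (A.neg a), hA.join_comm, h1] at h2
  exact h2.symm

theorem join_neg_eq (hA : A.IsRelationAlgebra) (a b : A.carrier) :
    A.join a (A.neg a) = A.join b (A.neg b) := by
  have := hA.join_comm
  have := hA.join_assoc
  have := hA.huntington a b
  have := hA.huntington b a
  have := hA.huntington (A.neg a) b
  have := hA.huntington (A.neg b) a
  have := hA.neg_neg a
  have := hA.neg_neg b
  grind

theorem join_self (hA : A.IsRelationAlgebra) (a : A.carrier) : A.join a a = a := by
  obtain ⟨o, ho⟩ : ∃ o, ∀ b, A.join b (A.neg b) = o := ⟨_, fun b => hA.join_neg_eq b a⟩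
  obtain ⟨z, hz⟩ : ∃ z, z = A.neg o := ⟨_, rfl⟩
  have nz : A.neg z = o := by rw [hz, hA.neg_neg]
  have oz : A.join o z = o := by rw [hz, ho]
  -- With `u = ¬(o ∨ o)` the axiom gives `z = u ∨ z`, and `o = (o ∨ o) ∨ u`.
  have h1 : A.join (A.neg (A.join o o)) z = z := by
    have := hA.huntington z z
    rw [nz, oz, ← hz, hA.join_comm] at this
    exact this
  have h2 := ho (A.join o o)
  have h3 : A.join o (A.neg (A.join o o)) = o := by
    calc A.join o (A.neg (A.join o o)) = A.join (A.join o z) (A.neg (A.join o o)) := by rw [oz]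
      _ = o := by rw [← hA.join_assoc, hA.join_comm z, h1, oz]
  have oo : A.join o o = o := by
    rwa [← hA.join_assoc, h3] at h2
  have zz : A.join z z = z := by rwa [oo, ← hz] at h1
  have key : ∀ b, A.join z b = b := by
    intro b
    have := hA.huntington b b
    rw [hA.join_comm (A.neg b) b, ho, ← hz] at this
    rw [← this, hA.join_assoc, zz]
  have := hA.huntington (A.neg a) (A.neg a)
  rw [hA.neg_neg, ho, ← hz, key] at this
  rw [← hA.neg_neg (A.join a a), this, hA.neg_neg]

/-- The Boolean algebra on a relation algebra; the meet of `a` and `b` is `¬(¬a ∨ ¬b)`. -/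
@[reducible] def booleanAlgebra (hA : A.IsRelationAlgebra) : BooleanAlgebra A.carrier :=
  let meet := fun a b => A.neg (A.join (A.neg a) (A.neg b))
  have le_trans' : ∀ a b c, A.join a b = b → A.join b c = c → A.join a c = c := by
    intro a b c h1 h2
    rw [← h2, hA.join_assoc, h1]
  have meet_le : ∀ a b, A.join (meet a b) a = a := by
    intro a b
    calc A.join (meet a b) a
        = A.join (meet a b) (A.join (A.neg (A.join (A.neg a) b)) (meet a b)) :=
          congrArg _ (hA.huntington a b).symm
      _ = A.join (A.neg (A.join (A.neg a) b)) (meet a b) := by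
          rw [hA.join_comm, ← hA.join_assoc, hA.join_self]
      _ = a := hA.huntington a b
  have meet_comm : ∀ a b, meet a b = meet b a := fun a b => by
    simp only [meet, hA.join_comm]
  have neg_anti : ∀ a b, A.join a b = b → A.join (A.neg b) (A.neg a) = A.neg a := by
    intro a b h
    have := meet_le (A.neg a) (A.neg b)
    simpa only [meet, hA.neg_neg, h] using this
  have join_le : ∀ a b c, A.join a c = c → A.join b c = c → A.join (A.join a b) c = c := by
    intro a b c h1 h2
    rw [← hA.join_assoc, h2, h1]
  have le_meet : ∀ a b c, A.join a b = b → A.join a c = c → A.join a (meet b c) = meet b c := by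
    intro a b c h1 h2
    have := neg_anti _ _ (join_le _ _ _ (neg_anti _ _ h1) (neg_anti _ _ h2))
    rwa [hA.neg_neg] at this
  have split : ∀ a b, A.join (meet a b) (meet a (A.neg b)) = a := by
    intro a b
    simp only [meet, hA.neg_neg]
    rw [hA.join_comm, hA.huntington]
  letI L : Lattice A.carrier :=
    { le := fun a b => A.join a b = b
      le_refl := hA.join_self
      le_trans := le_trans'
      le_antisymm := fun a b h1 h2 => by rw [← h2, hA.join_comm]; exact h1.symm ▸ h1 ▸ rfl
      sup := A.join
      le_sup_left := fun a b => by
        rw [hA.join_assoc, hA.join_self]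
      le_sup_right := fun a b => by
        rw [hA.join_comm a, hA.join_assoc, hA.join_self]
      sup_le := join_le
      inf := meet
      inf_le_left := meet_le
      inf_le_right := fun a b => by
        rw [meet_comm, meet_le]
      le_inf := le_meet }
  have bot_le' : ∀ a b : A.carrier, meet a (A.neg a) ≤ b := by
    intro a b
    have : meet a (A.neg a) = meet b (A.neg b) := by
      simp only [meet]
      rw [hA.join_neg_eq (A.neg a) (A.neg b)]
    rw [this]
    exact inf_le_left (a := b)
  have le_of_inf : ∀ a b : A.carrier, (∀ c, a ⊓ A.neg b ≤ c) → a ≤ b := by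
    intro a b h
    have := split a b
    rw [← this]
    exact sup_le inf_le_right (h b)
  have sub_le : ∀ x y : A.carrier, x ⊓ A.neg (x ⊓ y) ≤ A.neg y := by
    intro x y
    refine le_of_inf _ _ fun c => ?_
    rw [hA.neg_neg]
    refine _root_.le_trans ?_ (bot_le' (x ⊓ y) c)
    exact le_inf (le_inf (inf_le_left.trans inf_le_left) inf_le_right)
      (inf_le_left.trans inf_le_right)
  have dist : ∀ x y z : A.carrier, x ⊓ (y ⊔ z) ≤ (x ⊓ y) ⊔ (x ⊓ z) := by
    intro x y z
    refine le_of_inf _ _ fun c => ?_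
    refine _root_.le_trans ?_ (bot_le' (y ⊔ z) c)
    have h1 : A.neg ((x ⊓ y) ⊔ (x ⊓ z)) ≤ A.neg (x ⊓ y) := neg_anti _ _ (le_sup_left (a := x ⊓ y))
    have h2 : A.neg ((x ⊓ y) ⊔ (x ⊓ z)) ≤ A.neg (x ⊓ z) := neg_anti _ _ (le_sup_right (b := x ⊓ z))
    refine le_inf (inf_le_left.trans inf_le_right) ?_
    have h3 : A.neg y ⊓ A.neg z ≤ A.neg (y ⊔ z) := by
      have h : meet (A.neg y) (A.neg z) = A.neg (A.join y z) := by
        simp only [meet, hA.neg_neg]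
      exact le_of_eq h
    refine _root_.le_trans (le_inf ?_ ?_) h3
    · exact _root_.le_trans (inf_le_inf inf_le_left h1) (sub_le x y)
    · exact _root_.le_trans (inf_le_inf inf_le_left h2) (sub_le x z)
  letI D : DistribLattice A.carrier := DistribLattice.ofInfSupLe dist
  { D with
    top := A.join A.t (A.neg A.t)
    bot := meet A.t (A.neg A.t)
    compl := A.neg
    le_top := fun a => by
      rw [hA.join_neg_eq A.t a]
      exact le_sup_left (a := a)
    bot_le := bot_le' A.t
    inf_compl_le_bot := fun a => bot_le' a _
    top_le_sup_compl := fun a => le_of_eq (hA.join_neg_eq A.t a) }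

end IsRelationAlgebra

/-! ### Homomorphisms and subalgebras -/

theorem Hom.ext {f g : Hom A B} (h : ∀ a, f.toFun a = g.toFun a) : f = g := by
  cases f; cases g
  congr
  exact funext h

theorem IsRelationAlgebra.of_injective (hB : B.IsRelationAlgebra) (f : Hom A B)
    (hf : Function.Injective f.toFun) : A.IsRelationAlgebra where
  join_comm a b := hf <| by simp only [f.map_join]; apply hB.join_comm
  join_assoc a b c := hf <| by simp only [f.map_join]; apply hB.join_assoc
  huntington a b := hf <| by simp only [f.map_join, f.map_neg]; apply hB.huntington
  comp_assoc a b c := hf <| by simp only [f.map_comp]; apply hB.comp_assoc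
  comp_t a := hf <| by simp only [f.map_comp, f.map_t]; apply hB.comp_t
  conv_conv a := hf <| by simp only [f.map_conv]; apply hB.conv_conv
  conv_comp a b := hf <| by simp only [f.map_conv, f.map_comp]; apply hB.conv_comp
  join_comp a b c := hf <| by simp only [f.map_join, f.map_comp]; apply hB.join_comp
  conv_join a b := hf <| by simp only [f.map_conv, f.map_join]; apply hB.conv_join
  tarski a b := hf <| by
    simp only [f.map_conv, f.map_join, f.map_comp, f.map_neg]; apply hB.tarski

theorem IsSymmetric.of_injective (hB : B.IsSymmetric) (f : Hom A B)
    (hf : Function.Injective f.toFun) : A.IsSymmetric :=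
  fun a => hf <| by rw [f.map_conv]; apply hB

theorem IsDense.of_injective (hB : B.IsDense) (f : Hom A B)
    (hf : Function.Injective f.toFun) : A.IsDense :=
  fun a => hf <| by rw [f.map_join, f.map_comp]; apply hB

theorem denseSymmetricRA_of_injective (hB : B ∈ denseSymmetricRA) (f : Hom A B)
    (hf : Function.Injective f.toFun) : A ∈ denseSymmetricRA :=
  ⟨hB.1.of_injective f hf, hB.2.1.of_injective f hf, hB.2.2.of_injective f hf⟩

theorem IsSymmetric.isAbelian (hA : A.IsRelationAlgebra) (hs : A.IsSymmetric) : A.IsAbelian :=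
  fun a b => by rw [← hs (A.comp a b), hA.conv_comp, hs a, hs b]

theorem symmetricRA_subset_abelianRA : symmetricRA.{u} ⊆ abelianRA :=
  fun _ hA => ⟨hA.1, hA.2.isAbelian hA.1⟩

theorem denseSymmetricRA_subset_symmetricRA : denseSymmetricRA.{u} ⊆ symmetricRA :=
  fun _ hA => ⟨hA.1, hA.2.2⟩

/-- A set of elements closed under all the operations. -/
structure IsSubuniverse (A : RelTypeAlg.{u}) (S : Set A.carrier) : Prop where
  join : ∀ a ∈ S, ∀ b ∈ S, A.join a b ∈ S
  neg : ∀ a ∈ S, A.neg a ∈ S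
  comp : ∀ a ∈ S, ∀ b ∈ S, A.comp a b ∈ S
  conv : ∀ a ∈ S, A.conv a ∈ S
  t : A.t ∈ S

/-- The subalgebra with a given universe. -/
def IsSubuniverse.alg {S : Set A.carrier} (hS : A.IsSubuniverse S) : RelTypeAlg.{u} where
  carrier := S
  join a b := ⟨A.join a b, hS.join _ a.2 _ b.2⟩
  neg a := ⟨A.neg a, hS.neg _ a.2⟩
  comp a b := ⟨A.comp a b, hS.comp _ a.2 _ b.2⟩
  conv a := ⟨A.conv a, hS.conv _ a.2⟩
  t := ⟨A.t, hS.t⟩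

/-- The inclusion of a subalgebra. -/
def IsSubuniverse.incl {S : Set A.carrier} (hS : A.IsSubuniverse S) : Hom hS.alg A where
  toFun := Subtype.val
  map_join _ _ := rfl
  map_neg _ := rfl
  map_comp _ _ := rfl
  map_conv _ := rfl
  map_t := rfl

theorem IsSubuniverse.incl_injective {S : Set A.carrier} (hS : A.IsSubuniverse S) :
    Function.Injective hS.incl.toFun :=
  Subtype.val_injective

/-- A homomorphism whose values lie in a subalgebra, as a homomorphism into that subalgebra. -/
def Hom.codRestrict {S : Set A.carrier} (hS : A.IsSubuniverse S) (f : Hom B A)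
    (hf : ∀ b, f.toFun b ∈ S) : Hom B hS.alg where
  toFun b := ⟨f.toFun b, hf b⟩
  map_join _ _ := Subtype.ext (f.map_join _ _)
  map_neg _ := Subtype.ext (f.map_neg _)
  map_comp _ _ := Subtype.ext (f.map_comp _ _)
  map_conv _ := Subtype.ext (f.map_conv _)
  map_t := Subtype.ext f.map_t

theorem isSubuniverse_eqLocus (g h : Hom A B) : A.IsSubuniverse {a | h.toFun a = g.toFun a} where
  join a ha b hb := by simp_all [Hom.map_join]
  neg a ha := by simp_all [Hom.map_neg]
  comp a ha b hb := by simp_all [Hom.map_comp]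
  conv a ha := by simp_all [Hom.map_conv]
  t := by simp [Hom.map_t]

/-! ### The symmetric elements of an abelian relation algebra -/

theorem IsRelationAlgebra.conv_neg (hA : A.IsRelationAlgebra) (a : A.carrier) :
    A.conv (A.neg a) = A.neg (A.conv a) := by
  let := hA.booleanAlgebra
  let e : A.carrier ≃o A.carrier :=
    { toFun := A.conv
      invFun := A.conv
      left_inv := hA.conv_conv
      right_inv := hA.conv_conv
      map_rel_iff' := by
        intro a b
        change A.join (A.conv a) (A.conv b) = A.conv b ↔ A.join a b = b
        rw [← hA.conv_join]
        exact (Function.LeftInverse.injective hA.conv_conv).eq_iff }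
  exact (e.isCompl (isCompl_compl (x := a))).compl_eq.symm

theorem IsRelationAlgebra.conv_t (hA : A.IsRelationAlgebra) : A.conv A.t = A.t := by
  have h := hA.conv_comp (A.conv A.t) A.t
  rwa [hA.comp_t, hA.conv_conv, hA.comp_t, eq_comm] at h

theorem isSubuniverse_symmetric (hA : A ∈ abelianRA) : A.IsSubuniverse {a | A.conv a = a} where
  join a ha b hb := by
    simp only [Set.mem_ofPred_eq] at *
    rw [hA.1.conv_join, ha, hb]
  neg a ha := by
    simp only [Set.mem_ofPred_eq] at *
    rw [hA.1.conv_neg, ha]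
  comp a ha b hb := by
    simp only [Set.mem_ofPred_eq] at *
    rw [hA.1.conv_comp, ha, hb, hA.2]
  conv a ha := by
    simp only [Set.mem_ofPred_eq] at *
    rw [ha, ha]
  t := hA.1.conv_t

/-- A homomorphism from a symmetric algebra to an abelian relation algebra takes its values among
the symmetric elements. Hence epimorphisms between symmetric algebras can be tested with symmetric
codomains only. -/
theorem Hom.isEpi_abelianRA_of_symmetricRA {f : Hom A B} (hB : B.IsSymmetric)
    (hf : f.IsEpi symmetricRA) : f.IsEpi abelianRA := by
  intro C hC g h hgh
  have hS := isSubuniverse_symmetric hC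
  have sym : ∀ k : Hom B C, ∀ b, k.toFun b ∈ {a | C.conv a = a} := fun k b => by
    rw [Set.mem_ofPred_eq, ← k.map_conv, hB]
  have key := hf hS.alg ⟨hC.1.of_injective _ hS.incl_injective, fun a => Subtype.ext a.2⟩
    (g.codRestrict hS (sym g)) (h.codRestrict hS (sym h))
    (Hom.ext fun a => Subtype.ext (congrArg (fun k => k.toFun a) hgh))
  exact Hom.ext fun b => congrArg (fun k : Hom B hS.alg => (k.toFun b).1) key

theorem Hom.IsEpi.anti {V W : Set RelTypeAlg.{u}} (hVW : V ⊆ W) {f : Hom A B}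
    (hf : f.IsEpi W) : f.IsEpi V :=
  fun C hC => hf C (hVW hC)

/-- Every symmetric relation algebra in the sense of the given laws is a `SymmetricRelAlg`. -/
@[reducible] def symmetricRelAlg (hA : A ∈ symmetricRA) : SymmetricRelAlg A.carrier :=
  { hA.1.booleanAlgebra with
    mul := A.comp
    one := A.t
    mul_assoc := fun a b c => (hA.1.comp_assoc a b c).symm
    mul_comm := hA.2.isAbelian hA.1
    mul_one := hA.1.comp_t
    one_mul := fun a => (hA.2.isAbelian hA.1 A.t a).trans (hA.1.comp_t a)
    sup_mul := hA.1.join_comp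
    peirce := by
      let := hA.1.booleanAlgebra
      intro a b c h
      have h1 : c ≤ (A.comp a b)ᶜ := h.le_compl_left
      have h2 : A.comp a (A.comp a b)ᶜ ≤ bᶜ := by
        have := hA.1.tarski a b
        rwa [hA.2 a] at this
      have h3 : A.comp a c ≤ A.comp a (A.comp a b)ᶜ := by
        change A.join _ _ = _
        rw [hA.2.isAbelian hA.1 a c, hA.2.isAbelian hA.1 a, ← hA.1.join_comp]
        exact congrArg (fun d => A.comp d a) h1
      exact le_compl_iff_disjoint_right.mp (h3.trans h2) }

end RelTypeAlg

namespace RelTypeAlg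

/-! ### Complex algebras of modular lattices -/

/-- A complex algebra is a dense symmetric relation algebra if its ternary relation is reflexive,
totally symmetric and associative, with the distinguished point as identity. -/
theorem complexAlg_mem_denseSymmetricRA {S : Type u} {R : S → S → S → Prop} {e : S}
    (refl : ∀ a, R a a a) (swap_left : ∀ {a b c}, R a b c → R b a c)
    (swap_right : ∀ {a b c}, R a b c → R a c b) (ident : ∀ a b, R a e b ↔ a = b)
    (assoc : ∀ {a b c d u}, R a b u → R u c d → ∃ v, R b c v ∧ R a v d) :
    complexAlg S R e ∈ denseSymmetricRA := by
  let comp : Set S → Set S → Set S := (complexAlg S R e).comp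
  have hcomm : ∀ X Y, comp X Y = comp Y X := by
    have : ∀ X Y, comp X Y ⊆ comp Y X := by
      rintro X Y z ⟨x, hx, y, hy, h⟩
      exact ⟨y, hy, x, hx, swap_left h⟩
    exact fun X Y => (this X Y).antisymm (this Y X)
  have hassoc : ∀ X Y Z, comp (comp X Y) Z ⊆ comp X (comp Y Z) := by
    rintro X Y Z d ⟨u, ⟨a, ha, b, hb, h1⟩, c, hc, h2⟩
    obtain ⟨v, h3, h4⟩ := assoc h1 h2
    exact ⟨a, ha, v, ⟨b, hb, c, hc, h3⟩, h4⟩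
  have hassoc' : ∀ X Y Z, comp X (comp Y Z) = comp (comp X Y) Z := by
    intro X Y Z
    refine Set.Subset.antisymm ?_ (hassoc X Y Z)
    rw [hcomm X, hcomm Y, hcomm _ Z, hcomm X]
    exact hassoc Z Y X
  refine ⟨?_, ?_, fun X => rfl⟩
  · exact
    { join_comm := fun X Y => Set.union_comm X Y
      join_assoc := fun X Y Z => (Set.union_assoc X Y Z).symm
      huntington := fun (X : Set S) (Y : Set S) => by
        change (Xᶜ ∪ Y)ᶜ ∪ (Xᶜ ∪ Yᶜ)ᶜ = X
        ext z
        simp only [Set.mem_union, Set.mem_compl_iff]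
        tauto
      comp_assoc := hassoc'
      comp_t := fun X => by
        refine Set.ext fun z => ?_
        constructor
        · rintro ⟨x, hx, y, rfl, h⟩
          rwa [← (ident x z).mp h]
        · exact fun hz => ⟨z, hz, e, rfl, (ident z z).mpr rfl⟩
      conv_conv := fun _ => rfl
      conv_comp := hcomm
      join_comp := fun X Y Z => by
        refine Set.ext fun z => ?_
        constructor
        · rintro ⟨x, hx | hx, y, hy, h⟩
          exacts [Or.inl ⟨x, hx, y, hy, h⟩, Or.inr ⟨x, hx, y, hy, h⟩]
        · rintro (⟨x, hx, y, hy, h⟩ | ⟨x, hx, y, hy, h⟩)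
          exacts [⟨x, Or.inl hx, y, hy, h⟩, ⟨x, Or.inr hx, y, hy, h⟩]
      conv_join := fun _ _ => rfl
      tarski := fun X Y => by
        refine Set.union_eq_right.mpr ?_
        rintro z ⟨x, hx, y, hy, h⟩ hz
        exact hy ⟨x, hx, z, hz, swap_right h⟩ }
  · exact fun X => Set.union_eq_right.mpr fun z hz => ⟨z, hz, z, hz, refl z⟩

theorem latticeComplexAlg_mem_denseSymmetricRA (L : Type u) [Lattice L] [OrderBot L]
    [IsModularLattice L] : latticeComplexAlg L ∈ denseSymmetricRA := by
  refine complexAlg_mem_denseSymmetricRA (fun _ => ⟨rfl, rfl⟩) ?_ ?_ ?_ ?_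
  · rintro a b c ⟨h1, h2⟩
    exact ⟨by rw [sup_comm, h1, h2], h2.symm⟩
  · rintro a b c ⟨h1, h2⟩
    exact ⟨h1.symm, by rw [h1, h2, sup_comm]⟩
  · intro a b
    constructor
    · rintro ⟨h1, h2⟩
      rw [sup_bot_eq] at h1
      rw [bot_sup_eq, ← h1] at h2
      exact h2
    · rintro rfl
      simp
  · rintro a b c d u ⟨h1, h2⟩ ⟨h3, h4⟩
    have cd : c ≤ u ⊔ d := h3 ▸ le_sup_right
    have dc : d ≤ u ⊔ c := h3 ▸ le_sup_right
    have uc : u ≤ c ⊔ d := h4 ▸ le_sup_left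
    have ua : u ≤ a ⊔ b := h1 ▸ le_sup_right
    have ab : a ≤ b ⊔ u := h2 ▸ le_sup_left
    have ba : b ≤ a ⊔ u := h1 ▸ le_sup_right
    have l1 : ∀ s t w : L, s ≤ t ⊔ (s ⊔ w) := fun s t w => le_sup_left.trans le_sup_right
    have l2 : ∀ s t w : L, w ≤ t ⊔ (s ⊔ w) := fun s t w => le_sup_right.trans le_sup_right
    have key : ∀ s t w : L, t ≤ s ⊔ w → s ⊔ w ⊓ (s ⊔ t) = s ⊔ t := fun s t w h => by
      rw [← sup_inf_assoc_of_le w le_sup_left, inf_eq_right]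
      exact sup_le le_sup_left h
    have k1 : b ⊔ (a ⊔ d) ⊓ (b ⊔ c) = b ⊔ c :=
      key b c _ (cd.trans (sup_le (ua.trans (sup_le (l1 a b d) le_sup_left)) (l2 a b d)))
    have k2 : c ⊔ (a ⊔ d) ⊓ (b ⊔ c) = b ⊔ c := by
      rw [sup_comm b]
      exact key c b _ (ba.trans (sup_le (l1 a c d) (uc.trans (sup_le le_sup_left (l2 a c d)))))
    have k3 : a ⊔ (a ⊔ d) ⊓ (b ⊔ c) = a ⊔ d := by
      rw [inf_comm]
      exact key a d _ (dc.trans (sup_le (ua.trans (sup_le le_sup_left (l1 b a c))) (l2 b a c)))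
    have k4 : (a ⊔ d) ⊓ (b ⊔ c) ⊔ d = a ⊔ d := by
      rw [sup_comm _ d, inf_comm, sup_comm a]
      exact key d a _ (ab.trans (sup_le (l1 b d c) (uc.trans (sup_le (l2 b d c) le_sup_left))))
    -- In projective terms, `(a ⊔ d) ⊓ (b ⊔ c)` is the point given by Pasch's axiom.
    exact ⟨(a ⊔ d) ⊓ (b ⊔ c), ⟨k1.symm, k1.trans k2.symm⟩, ⟨k3, k4.symm⟩⟩

theorem latticeRA_subset_denseSymmetricRA : latticeRA.{u} ⊆ denseSymmetricRA := by
  rintro A ⟨L, _, _, _, f, hf⟩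
  exact denseSymmetricRA_of_injective (latticeComplexAlg_mem_denseSymmetricRA L) f hf

end RelTypeAlg

/-! ### Symmetric subsets of an abelian group of exponent three -/

/-- The subsets `X` of an additive group with `-X = X`. -/
def SymmSet (G : Type u) [AddCommGroup G] : Type u := {X : Set G // ∀ z ∈ X, -z ∈ X}

namespace SymmSet

variable {G : Type u} [AddCommGroup G]

theorem ext {X Y : SymmSet G} (h : ∀ z, z ∈ X.1 ↔ z ∈ Y.1) : X = Y := Subtype.ext (Set.ext h)

theorem neg_mem_iff (X : SymmSet G) {z : G} : -z ∈ X.1 ↔ z ∈ X.1 :=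
  ⟨fun h => neg_neg z ▸ X.2 _ h, X.2 z⟩

/-- The union of two symmetric sets. -/
def union (X Y : SymmSet G) : SymmSet G :=
  ⟨X.1 ∪ Y.1, fun z hz => hz.imp (X.2 z) (Y.2 z)⟩

/-- The complement of a symmetric set. -/
def compl (X : SymmSet G) : SymmSet G :=
  ⟨X.1ᶜ, fun _ hz h => hz (X.neg_mem_iff.mp h)⟩

/-- The elementwise sum of two symmetric sets. -/
def sum (X Y : SymmSet G) : SymmSet G :=
  ⟨X.1 + Y.1, by
    rintro _ ⟨x, hx, y, hy, rfl⟩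
    exact ⟨-x, X.2 x hx, -y, Y.2 y hy, (neg_add x y).symm⟩⟩

/-- The symmetric set `{v, -v}`. For a group of exponent three, the sets `{v, -v}` with `v ≠ 0` are
the points of a projective geometry over the field with three elements. -/
def point (v : G) : SymmSet G :=
  ⟨{v, -v}, by rintro z (rfl | rfl) <;> simp⟩

theorem mem_point {v z : G} : z ∈ (point v).1 ↔ z = v ∨ z = -v := Iff.rfl

theorem point_neg (v : G) : point (-v) = point v :=
  ext fun z => by rw [mem_point, mem_point, neg_neg, or_comm]

theorem point_subset {X : SymmSet G} {v : G} (hv : v ∈ X.1) : (point v).1 ⊆ X.1 := by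
  rintro z (rfl | rfl)
  exacts [hv, X.2 _ hv]

theorem sum_point_point (v w : G) :
    (point v).sum (point w) = (point (v + w)).union (point (v - w)) := by
  refine ext fun z => ?_
  constructor
  · rintro ⟨x, rfl | rfl, y, rfl | rfl, rfl⟩
    · exact Or.inl (Or.inl rfl)
    · exact Or.inr (Or.inl (sub_eq_add_neg _ _).symm)
    · exact Or.inr (Or.inr (by simp [sub_eq_neg_add]))
    · exact Or.inl (Or.inr (neg_add _ _).symm)
  · rintro ((rfl | rfl) | (rfl | rfl))
    · exact ⟨v, Or.inl rfl, w, Or.inl rfl, rfl⟩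
    · exact ⟨-v, Or.inr rfl, -w, Or.inr rfl, (neg_add _ _).symm⟩
    · exact ⟨v, Or.inl rfl, -w, Or.inr rfl, (sub_eq_add_neg _ _).symm⟩
    · exact ⟨-v, Or.inr rfl, w, Or.inl rfl, by simp only [sub_eq_neg_add, neg_add_rev, neg_neg]⟩

end SymmSet

open SymmSet

namespace RelTypeAlg

/-- The algebra of all symmetric subsets of an abelian group, with elementwise sum as composition
and `t = {0}`. -/
def symmSetAlg (G : Type u) [AddCommGroup G] : RelTypeAlg.{u} where
  carrier := SymmSet G
  join := union
  neg := compl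
  comp := sum
  conv X := X
  t := point 0

theorem symmSetAlg_mem_denseSymmetricRA {G : Type u} [AddCommGroup G]
    (h3 : ∀ v : G, v + v = -v) : symmSetAlg G ∈ denseSymmetricRA := by
  refine ⟨?_, ?_, fun X => rfl⟩
  · exact
    { join_comm := fun X Y => Subtype.ext (Set.union_comm X.1 Y.1)
      join_assoc := fun X Y Z => Subtype.ext (Set.union_assoc X.1 Y.1 Z.1).symm
      huntington := fun X Y => SymmSet.ext fun z => by
        change ¬ (¬ z ∈ X.1 ∨ z ∈ Y.1) ∨ ¬ (¬ z ∈ X.1 ∨ ¬ z ∈ Y.1) ↔ z ∈ X.1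
        tauto
      comp_assoc := fun X Y Z => Subtype.ext (add_assoc X.1 Y.1 Z.1).symm
      comp_t := fun X => SymmSet.ext fun z => by
        constructor
        · rintro ⟨x, hx, y, hy, rfl⟩
          have : y = 0 := by rcases hy with rfl | rfl <;> simp
          simpa [this] using hx
        · exact fun hz => ⟨z, hz, 0, Or.inl rfl, add_zero z⟩
      conv_conv := fun _ => rfl
      conv_comp := fun X Y => Subtype.ext (add_comm X.1 Y.1)
      join_comp := fun X Y Z => Subtype.ext Set.union_add
      conv_join := fun _ _ => rfl
      tarski := fun X Y => Subtype.ext <| Set.union_eq_right.mpr <| by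
        rintro z ⟨x, hx, y, hy, rfl⟩ hz
        exact hy ⟨-x, X.2 x hx, x + y, hz, by simp⟩ }
  · refine fun X => Subtype.ext <| Set.union_eq_right.mpr fun z hz => ?_
    exact ⟨-z, X.2 z hz, -z, X.2 z hz, by simp only [h3, neg_neg]⟩

end RelTypeAlg

/-- A homomorphism from the algebra of symmetric subsets of `G` to a `SymmetricRelAlg`. -/
structure SymmSetHom (G : Type u) [AddCommGroup G] (α : Type u) [SymmetricRelAlg α] where
  toFun : SymmSet G → α
  map_union : ∀ X Y, toFun (X.union Y) = toFun X ⊔ toFun Y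
  map_compl : ∀ X, toFun X.compl = (toFun X)ᶜ
  map_sum : ∀ X Y, toFun (X.sum Y) = toFun X * toFun Y
  map_zero : toFun (point 0) = 1

namespace SymmSetHom

open SymmetricRelAlg

variable {G : Type u} [AddCommGroup G] {α : Type u} [SymmetricRelAlg α]

instance : CoeFun (SymmSetHom G α) (fun _ => SymmSet G → α) := ⟨toFun⟩

variable (k h g : SymmSetHom G α)

theorem mono {X Y : SymmSet G} (hXY : X.1 ⊆ Y.1) : k X ≤ k Y := by
  have : X.union Y = Y := Subtype.ext (Set.union_eq_right.mpr hXY)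
  rw [← this, k.map_union]
  exact le_sup_left

theorem disjoint {X Y : SymmSet G} (hXY : ∀ z ∈ X.1, z ∉ Y.1) : Disjoint (k X) (k Y) := by
  rw [← le_compl_iff_disjoint_right, ← k.map_compl]
  exact k.mono hXY

theorem disjoint_point {v : G} {X : SymmSet G} (hv : v ∉ X.1) : Disjoint (k (point v)) (k X) := by
  refine k.disjoint ?_
  rintro z (rfl | rfl)
  exacts [hv, mt X.neg_mem_iff.mp hv]

theorem disjoint_point_point {v w : G} (h1 : v ≠ w) (h2 : v ≠ -w) :
    Disjoint (k (point v)) (k (point w)) :=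
  k.disjoint_point fun h => h.elim h1 h2

theorem map_point_mul (v w : G) :
    k (point v) * k (point w) = k (point (v + w)) ⊔ k (point (v - w)) := by
  rw [← k.map_sum, sum_point_point, k.map_union]

theorem map_point_mul_self (h3 : ∀ v : G, v + v = -v) (v : G) :
    k (point v) * k (point v) = 1 ⊔ k (point v) := by
  rw [k.map_point_mul, h3, point_neg, sub_self, k.map_zero, sup_comm]

/-- As `G` is finite, the image of a symmetric set is the join of the images of its points. -/
theorem disjoint_of_points [Finite G] {p : α} {X : SymmSet G}
    (hp : ∀ v ∈ X.1, Disjoint p (k (point v))) : Disjoint p (k X) := by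
  have key : ∀ S : Set G, S.Finite → ∀ Y : SymmSet G, (∀ v ∈ Y.1, Disjoint p (k (point v))) →
      (∀ z ∈ Y.1, z ∈ S ∨ -z ∈ S) → Disjoint p (k Y) := by
    intro S hS
    induction S, hS using Set.Finite.induction_on with
    | empty =>
      intro Y _ hYS
      have : Disjoint (k Y) (k Y) := k.disjoint fun z hz => by simpa using hYS z hz
      rw [disjoint_self.mp this]
      exact disjoint_bot_right
    | @insert a S _ _ ih =>
      intro Y hY hYS
      by_cases ha : a ∈ Y.1
      · obtain ⟨Z, hZ⟩ : ∃ Z : SymmSet G, ∀ z, z ∈ Z.1 ↔ z ∈ Y.1 ∧ z ∉ (point a).1 :=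
          ⟨⟨Y.1 ∩ (point a).compl.1, fun z hz => ⟨Y.2 z hz.1, (point a).compl.2 z hz.2⟩⟩,
            fun z => Iff.rfl⟩
        have hYZ : Y = (point a).union Z := SymmSet.ext fun z => by
          change _ ↔ _ ∨ z ∈ Z.1
          rw [hZ]
          by_cases hz : z ∈ (point a).1
          · simp [hz, point_subset ha hz]
          · simp [hz]
        rw [hYZ, k.map_union, disjoint_sup_right]
        refine ⟨hY a ha, ih Z (fun v hv => hY v ((hZ v).mp hv).1) fun z hz => ?_⟩
        obtain ⟨hz1, hz2⟩ := (hZ z).mp hz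
        rw [mem_point, not_or] at hz2
        refine (hYS z hz1).imp (fun h => h.resolve_left hz2.1) fun h => h.resolve_left ?_
        exact fun h => hz2.2 (by rw [← h, neg_neg])
      · refine ih Y hY fun z hz => (hYS z hz).imp (fun h => h.resolve_left ?_)
          fun h => h.resolve_left ?_
        · rintro rfl; exact ha hz
        · rintro rfl; exact ha (Y.2 z hz)
  exact key Set.univ Set.finite_univ X hp fun z _ => Or.inl trivial

theorem le_of_disjoint_points [Finite G] {p : α} {X : SymmSet G}
    (hp : ∀ v, v ∉ X.1 → Disjoint p (k (point v))) : p ≤ k X := by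
  rw [← compl_compl (k X), le_compl_iff_disjoint_right, ← k.map_compl]
  exact k.disjoint_of_points hp

theorem eq_bot_of_disjoint_points [Finite G] {p : α}
    (hp : ∀ v, Disjoint p (k (point v))) : p = ⊥ := by
  have h1 : p ≤ k (point 0) := k.le_of_disjoint_points fun v _ => hp v
  exact (hp 0).eq_bot_of_le h1

theorem le_of_point_eq [Finite G] (hgh : ∀ v, h (point v) = g (point v)) (X : SymmSet G) :
    h X ≤ g X :=
  g.le_of_disjoint_points fun v hv => hgh v ▸ (h.disjoint_point hv).symm

/-- The minimality of points in the image of a homomorphism. -/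
theorem mul_sdiff_eq_bot (h3 : ∀ v : G, v + v = -v) {v x : G} (hv : v ≠ 0) (hx : x ≠ 0)
    (h1 : x ≠ v) (h2 : x ≠ -v) {p : α} (hp : p ≤ k (point v)) (hpp : p * p ≤ 1 ⊔ p) :
    p * (k (point v) \ p) = ⊥ := by
  have hvv := h3 v
  have hxx := h3 x
  have ne : v ≠ -x ∧ (v ≠ v + x ∧ v ≠ -(v + x)) ∧ (v ≠ v - x ∧ v ≠ -(v - x)) ∧
      (x ≠ v + x ∧ x ≠ -(v + x)) ∧ (x ≠ v - x ∧ x ≠ -(v - x)) := by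
    refine ⟨fun h => h2 ?_, ⟨fun h => hx ?_, fun h => h1 ?_⟩, ⟨fun h => hx ?_, fun h => h2 ?_⟩,
      ⟨fun h => hv ?_, fun h => h1 ?_⟩, fun h => h2 ?_, fun h => hv ?_⟩
    · rw [h, neg_neg]
    · linear_combination (norm := abel) -h
    · linear_combination (norm := abel) h - hvv
    · linear_combination (norm := abel) h
    · linear_combination (norm := abel) hvv - h
    · linear_combination (norm := abel) -h
    · linear_combination (norm := abel) hxx - h
    · linear_combination (norm := abel) hxx - h
    · linear_combination (norm := abel) h
  have mul : ∀ a b c d : G, (a + b = c ∨ a + b = -c) → (a - b = d ∨ a - b = -d) →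
      k (point a) * k (point b) = k (point c) ⊔ k (point d) := by
    rintro a b c d (hc | hc) (hd | hd) <;>
      simp only [map_point_mul, hc, hd, point_neg]
  have self := k.map_point_mul_self h3
  have e1 : v + (v + x) = -(v - x) := by rw [← add_assoc, hvv]; abel
  have e2 : v + (v - x) = -(v + x) := by rw [add_sub, hvv]; abel
  have e3 : x + (v + x) = v - x := by rw [add_left_comm, hxx]; abel
  refine SymmetricRelAlg.mul_sdiff_eq_bot (x := k (point x)) (y := k (point (v + x)))
    (z := k (point (v - x))) (by rw [self]; exact le_sup_left) (self x).le (self _).le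
    (self _).le (k.map_point_mul v x) ?_ ?_ ?_ ?_ ?_ ?_ ?_ ?_ ?_ ?_ hp hpp
  · rw [sup_comm]
    exact mul _ _ _ _ (Or.inr e1) (Or.inr (by abel))
  · rw [sup_comm]
    exact mul _ _ _ _ (Or.inr e2) (Or.inl (by abel))
  · rw [mul x (v + x) (v - x) v (Or.inl e3) (Or.inr (by abel))]
    exact le_sup_right
  · rw [mul x (v - x) v (x - (v - x)) (Or.inl (by abel)) (Or.inl rfl)]
    exact le_sup_left
  · rw [← k.map_zero]
    exact k.disjoint_point_point hx (by simpa using hx)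
  · exact k.disjoint_point_point h1.symm ne.1
  · exact k.disjoint_point_point ne.2.1.1 ne.2.1.2
  · exact k.disjoint_point_point ne.2.2.1.1 ne.2.2.1.2
  · exact k.disjoint_point_point ne.2.2.2.1.1 ne.2.2.2.1.2
  · exact k.disjoint_point_point ne.2.2.2.2.1 ne.2.2.2.2.2

end SymmSetHom

open SymmSet RelTypeAlg

/-! ### The subalgebra of saturated sets -/

/-- A family of subgroups of `W`, indexed by the vectors of the plane over the field with three
elements. The set `{±(w + n, e) | n ∈ N e}` will be an atom of a subalgebra of the symmetric subsets
of `W × (ZMod 3 × ZMod 3)`; `zero`, `neg` and `add_le` say that these sets are closed under sums.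
By `rigid`, no linear map `φ` from the plane to `W` with `φ e ∈ N e` for all `e` moves `(1, 0)`. -/
structure IsRigidFamily {W : Type u} [AddCommGroup W]
    (N : ZMod 3 × ZMod 3 → AddSubgroup W) : Prop where
  zero : N 0 = ⊥
  neg : ∀ e, N (-e) = N e
  add_le : ∀ e e', N (e + e') ≤ N e ⊔ N e'
  ne_top : ∀ e, e ≠ 0 → N e ≠ ⊤
  ne_bot : N (1, 0) ≠ ⊥
  inf_add : ∀ m, m ∈ N (0, 1) → m ∈ N (1, 1) → m = 0
  inf_sub : ∀ m, m ∈ N (0, 1) → m ∈ N (1, -1) → m = 0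
  rigid : ∀ n m, n ∈ N (1, 0) → m ∈ N (0, 1) → n + m ∈ N (1, 1) → n - m ∈ N (1, -1) → n = 0

section Saturated

variable {W : Type u} [AddCommGroup W] {N : ZMod 3 × ZMod 3 → AddSubgroup W}

/-- The symmetric subsets of `W × (ZMod 3 × ZMod 3)` whose fibre over each `e` is a union of cosets
of `N e`. -/
def saturated (N : ZMod 3 × ZMod 3 → AddSubgroup W) : Set (SymmSet (W × (ZMod 3 × ZMod 3))) :=
  {X | ∀ z ∈ X.1, ∀ n ∈ N z.2, (z.1 + n, z.2) ∈ X.1}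

theorem isSubuniverse_saturated (hN : IsRigidFamily N) :
    (symmSetAlg (W × (ZMod 3 × ZMod 3))).IsSubuniverse (saturated N) where
  join X hX Y hY z hz n hn := hz.imp (fun h => hX z h n hn) fun h => hY z h n hn
  neg X hX z hz n hn h := hz <| by simpa using hX _ h (-n) (neg_mem hn)
  comp X hX Y hY := by
    rintro _ ⟨x, hx, y, hy, rfl⟩ n hn
    obtain ⟨a, ha, b, hb, rfl⟩ := AddSubgroup.mem_sup.mp (hN.add_le x.2 y.2 hn)
    exact ⟨_, hX x hx a ha, _, hY y hy b hb, Prod.ext (by simp; abel) rfl⟩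
  conv X hX := hX
  t := by
    intro z hz n hn
    have hz : z = 0 := by rcases hz with rfl | rfl <;> simp
    subst hz
    have hn : n ∈ N 0 := hn
    rw [hN.zero, AddSubgroup.mem_bot] at hn
    subst hn
    exact Or.inl (by simp)

/-- The smallest saturated symmetric set that contains `v`. -/
def fibre (N : ZMod 3 × ZMod 3 → AddSubgroup W) (v : W × (ZMod 3 × ZMod 3)) :
    SymmSet (W × (ZMod 3 × ZMod 3)) :=
  ⟨{z | (z.2 = v.2 ∧ z.1 - v.1 ∈ N v.2) ∨ (z.2 = -v.2 ∧ z.1 + v.1 ∈ N v.2)}, by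
    rintro z (⟨h1, h2⟩ | ⟨h1, h2⟩)
    · refine Or.inr ⟨by simp [h1], ?_⟩
      simpa [sub_eq_neg_add, add_comm] using neg_mem h2
    · refine Or.inl ⟨by simp [h1], ?_⟩
      simpa [sub_eq_neg_add, add_comm] using neg_mem h2⟩

theorem fibre_mem_saturated (hN : IsRigidFamily N) (v : W × (ZMod 3 × ZMod 3)) : fibre N v ∈ saturated N := by
  rintro z (⟨h1, h2⟩ | ⟨h1, h2⟩) n hn
  · rw [h1] at hn
    refine Or.inl ⟨h1, ?_⟩
    simpa [add_sub_right_comm] using add_mem h2 hn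
  · rw [h1, hN.neg] at hn
    refine Or.inr ⟨h1, ?_⟩
    simpa [add_right_comm] using add_mem h2 hn

theorem self_mem_fibre (N : ZMod 3 × ZMod 3 → AddSubgroup W) (v : W × (ZMod 3 × ZMod 3)) : v ∈ (fibre N v).1 :=
  Or.inl ⟨rfl, by simp⟩

theorem mem_fibre_zero {e : ZMod 3 × ZMod 3} {z : W × (ZMod 3 × ZMod 3)}
    (hz : z ∈ (fibre N (0, e)).1) : z.1 ∈ N e ∧ (z.2 = e ∨ z.2 = -e) := by
  rcases hz with ⟨h1, h2⟩ | ⟨h1, h2⟩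
  · exact ⟨by simpa using h2, Or.inl h1⟩
  · exact ⟨by simpa using h2, Or.inr h1⟩

/-! ### Points are determined by the saturated sets -/

/-- If the point of `u` is the only point of `point v + X` in its fibre, it is generated by
`point v`, `X` and the saturated sets. -/
theorem point_mem_of_unique (hN : IsRigidFamily N) {E : Set (SymmSet (W × (ZMod 3 × ZMod 3)))}
    (hE : (symmSetAlg (W × (ZMod 3 × ZMod 3))).IsSubuniverse E) (hsat : saturated N ⊆ E)
    {u v w : W × (ZMod 3 × ZMod 3)} {X : SymmSet (W × (ZMod 3 × ZMod 3))} (hv : point v ∈ E)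
    (hX : X ∈ E) (hw : w ∈ X.1) (hu : u = v + w)
    (huniq : ∀ z ∈ X.1, v + z ∈ (fibre N u).1 → v + z = u ∨ v + z = -u) : point u ∈ E := by
  have h1 := hE.comp _ hv _ hX
  have h2 := hE.neg _ (hE.join _ (hE.neg _ h1) _ (hE.neg _ (hsat (fibre_mem_saturated hN u))))
  suffices heq : point u = (((point v).sum X).compl.union (fibre N u).compl).compl from heq ▸ h2
  refine SymmSet.ext fun z => ?_
  change _ ↔ ¬ (¬ z ∈ (point v).1 + X.1 ∨ ¬ z ∈ (fibre N u).1)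
  rw [not_or, Classical.not_not, Classical.not_not]
  constructor
  · intro hz
    refine ⟨?_, point_subset (self_mem_fibre N u) hz⟩
    have : (point u).1 ⊆ ((point v).sum X).1 :=
      point_subset ⟨v, Or.inl rfl, w, hw, hu.symm⟩
    exact this hz
  · rintro ⟨⟨x, rfl | rfl, y, hy, rfl⟩, hz⟩
    · exact huniq y hy hz
    · have hz' : v + -y ∈ (fibre N u).1 := by
        have := (fibre N u).2 _ hz
        simpa [add_comm] using this
      rw [← (point u).neg_mem_iff, mem_point]
      have := huniq _ (X.2 y hy) hz'
      simpa [add_comm] using this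

theorem point_mem_of_point_one_zero_mem (hN : IsRigidFamily N) (h3 : ∀ w : W, w + w = -w)
    {E : Set (SymmSet (W × (ZMod 3 × ZMod 3)))}
    (hE : (symmSetAlg (W × (ZMod 3 × ZMod 3))).IsSubuniverse E) (hsat : saturated N ⊆ E)
    (h1 : point ((0, (1, 0)) : W × (ZMod 3 × ZMod 3)) ∈ E) (v : W × (ZMod 3 × ZMod 3)) :
    point v ∈ E := by
  have hfib := fun v => hsat (fibre_mem_saturated hN v)
  have h11 : point ((0, (1, 1)) : W × (ZMod 3 × ZMod 3)) ∈ E := by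
    refine point_mem_of_unique hN hE hsat h1 (hfib (0, (0, 1))) (self_mem_fibre N _)
      (by ext <;> simp) ?_
    rintro ⟨m, e⟩ hz hz'
    obtain ⟨hm, he⟩ := mem_fibre_zero hz
    obtain ⟨hm', he'⟩ := mem_fibre_zero hz'
    have : m = 0 := hN.inf_add m hm (by simpa using hm')
    subst this
    exact he'.imp (fun h => Prod.ext (by simp) h) fun h => Prod.ext (by simp) h
  have h12 : point ((0, (1, -1)) : W × (ZMod 3 × ZMod 3)) ∈ E := by
    refine point_mem_of_unique hN hE hsat h1 (hfib (0, (0, 1)))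
      ((fibre N _).2 _ (self_mem_fibre N _)) (by ext <;> simp) ?_
    rintro ⟨m, e⟩ hz hz'
    obtain ⟨hm, he⟩ := mem_fibre_zero hz
    obtain ⟨hm', he'⟩ := mem_fibre_zero hz'
    have : m = 0 := hN.inf_sub m hm (by simpa using hm')
    subst this
    exact he'.imp (fun h => Prod.ext (by simp) h) fun h => Prod.ext (by simp) h
  have h01 : point ((0, (0, 1)) : W × (ZMod 3 × ZMod 3)) ∈ E := by
    rw [← point_neg]
    refine point_mem_of_unique (w := -(0, (1, 1))) hN hE hsat h1 h11 (Or.inr rfl)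
      (by ext <;> simp) ?_
    rintro z (rfl | rfl) hz'
    · exfalso
      rcases hz' with ⟨h, _⟩ | ⟨h, _⟩
      · change ((1, 0) : ZMod 3 × ZMod 3) + (1, 1) = -(0, 1) at h
        revert h
        decide
      · change ((1, 0) : ZMod 3 × ZMod 3) + (1, 1) = - -(0, 1) at h
        revert h
        decide
    · exact Or.inl (by ext <;> simp)
  have h0 : ∀ e, point ((0, e) : W × (ZMod 3 × ZMod 3)) ∈ E := by
    intro e
    have : e = 0 ∨ e = (1, 0) ∨ e = -(1, 0) ∨ e = (0, 1) ∨ e = -(0, 1) ∨ e = (1, 1) ∨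
        e = -(1, 1) ∨ e = (1, -1) ∨ e = -(1, -1) := by
      revert e; decide
    have hneg : ∀ e : ZMod 3 × ZMod 3, ((0, -e) : W × (ZMod 3 × ZMod 3)) = -(0, e) :=
      fun e => by simp
    rcases this with rfl | rfl | rfl | rfl | rfl | rfl | rfl | rfl | rfl <;>
      first
      | assumption
      | (rw [hneg, point_neg]; assumption)
      | exact hE.t
  -- The points over `0` are saturated.
  have hW : ∀ a, point ((a, 0) : W × (ZMod 3 × ZMod 3)) ∈ E := by
    intro a
    suffices heq : point (a, 0) = fibre N (a, 0) from heq ▸ hfib (a, 0)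
    refine SymmSet.ext fun z => ?_
    change z = _ ∨ z = _ ↔ (z.2 = 0 ∧ z.1 - a ∈ N 0) ∨ (z.2 = -0 ∧ z.1 + a ∈ N 0)
    rw [hN.zero, AddSubgroup.mem_bot, AddSubgroup.mem_bot, sub_eq_zero, add_eq_zero_iff_eq_neg]
    simp [Prod.ext_iff, and_comm]
  have ne_neg : ∀ e : ZMod 3 × ZMod 3, e ≠ 0 → e ≠ -e := by decide
  -- A translate of a point over `e` by `b` is separated from its translate by `-b` when `b ∉ N e`.
  have htrans : ∀ (e : ZMod 3 × ZMod 3), e ≠ 0 → ∀ a b : W, b ∉ N e →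
      point ((a, e) : W × (ZMod 3 × ZMod 3)) ∈ E →
      point ((a + b, e) : W × (ZMod 3 × ZMod 3)) ∈ E := by
    intro e he a b hb ha
    refine point_mem_of_unique (w := (b, 0)) hN hE hsat ha (hW b) (Or.inl rfl) (by simp) ?_
    rintro z (rfl | rfl) hz'
    · exact Or.inl (by simp)
    · exfalso
      rcases hz' with ⟨_, h⟩ | ⟨h, _⟩
      · refine hb ?_
        have h' : (a + -b) - (a + b) ∈ N e := h
        have e1 : (a + -b) - (a + b) = b := by linear_combination (norm := abel) -h3 b
        rwa [e1] at h'
      · have h' : e + -0 = -e := h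
        rw [neg_zero, add_zero] at h'
        exact ne_neg e he h'
  obtain ⟨a, e⟩ := v
  by_cases he : e = 0
  · exact he ▸ hW a
  by_cases ha : a ∈ N e
  · obtain ⟨b, -, hb⟩ := SetLike.exists_of_lt (lt_top_iff_ne_top.mpr (hN.ne_top e he))
    have hab : a - b ∉ N e := fun h => hb (by simpa using sub_mem ha h)
    have := htrans e he 0 b hb (h0 e)
    have := htrans e he _ (a - b) hab this
    simpa using this
  · simpa using htrans e he 0 a ha (h0 e)

end Saturated

open SymmSet RelTypeAlg

/-! ### The inclusion of the saturated sets is an epimorphism -/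

namespace SymmetricRelAlg

variable {α : Type*} [SymmetricRelAlg α]

/-- If `q` is all of `b` wherever it does not vanish, then `p ≤ b * s` gives `p ≤ q * s` there. -/
theorem mul_eq_bot_of_disjoint {p q b s : α} (hq : q ≤ b) (hqb : q * (b \ q) = ⊥)
    (hp : p ≤ b * s) (hd : Disjoint (p * q) s) : p * q = ⊥ := by
  have h1 : p ≤ q * s ⊔ (b \ q) * s := by
    rwa [← sup_mul, sup_sdiff_cancel_right hq]
  have h2 : Disjoint p (q * s) := by rwa [← disjoint_mul_comm, mul_comm]
  have h3 : p ≤ (b \ q) * s := h2.left_le_of_le_sup_left h1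
  rw [← le_bot_iff]
  calc p * q ≤ ((b \ q) * s) * q := mul_mono h3 le_rfl
    _ = (q * (b \ q)) * s := by ac_rfl
    _ ≤ ⊥ := by rw [hqb, bot_mul]

end SymmetricRelAlg

open SymmetricRelAlg

section Epi

variable {W : Type u} [AddCommGroup W] {N : ZMod 3 × ZMod 3 → AddSubgroup W}

theorem exists_point_eq_of_mem_fibre {e : ZMod 3 × ZMod 3} {z : W × (ZMod 3 × ZMod 3)}
    (hz : z ∈ (fibre N (0, e)).1) : ∃ n ∈ N e, point z = point (n, e) := by
  obtain ⟨hn, he | he⟩ := mem_fibre_zero hz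
  · exact ⟨z.1, hn, by rw [← he]⟩
  · exact ⟨-z.1, neg_mem hn, by
      rw [← point_neg]
      exact congrArg point (Prod.ext rfl (neg_eq_iff_eq_neg.mpr he))⟩

variable [Finite W] {α : Type u} [SymmetricRelAlg α]

/-- Homomorphisms `h` and `g` that agree on saturated sets agree at the point `(0, (1, 0))`. If
`h` of this point met `g` of another point `(n, (1, 0))` of its fibre, then by the minimality of
points there would be a simultaneous choice of a displacement `m` of `(0, (0, 1))` with `n + m` and
`n - m` in the subgroups for `(1, 1)` and `(1, -1)`, which `IsRigidFamily.rigid` excludes. -/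
theorem map_point_one_zero_le (hN : IsRigidFamily N) (h3 : ∀ w : W, w + w = -w)
    (h g : SymmSetHom (W × (ZMod 3 × ZMod 3)) α) (hgh : ∀ X ∈ saturated N, h X = g X) :
    h (point (0, (1, 0))) ≤ g (point (0, (1, 0))) := by
  have h3' : ∀ v : W × (ZMod 3 × ZMod 3), v + v = -v := fun v =>
    Prod.ext (h3 v.1) ((by decide : ∀ e : ZMod 3 × ZMod 3, e + e = -e) v.2)
  have hfib : ∀ v, h (point v) ≤ g (fibre N v) := fun v => by
    rw [← hgh _ (fibre_mem_saturated hN v)]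
    exact h.mono (point_subset (self_mem_fibre N v))
  have ne : ¬ ((1, 1) = ((1, -1) : ZMod 3 × ZMod 3) ∨ (1, 1) = (-(1, -1) : ZMod 3 × ZMod 3)) ∧
      ¬ ((1, -1) = ((1, 1) : ZMod 3 × ZMod 3) ∨ (1, -1) = (-(1, 1) : ZMod 3 × ZMod 3)) := by decide
  -- The product of the parts of the two points that `g` displaces by `n` and by `m` vanishes.
  have core : ∀ n m, n ∈ N (1, 0) → m ∈ N (0, 1) → n ≠ 0 →
      (h (point (0, (1, 0))) ⊓ g (point (n, (1, 0)))) *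
        (h (point (0, (0, 1))) ⊓ g (point (m, (0, 1)))) = ⊥ := by
    intro n m hn hm hn0
    obtain ⟨b, hb⟩ : ∃ b, b = h (point (0, (0, 1))) := ⟨_, rfl⟩
    obtain ⟨q, hq⟩ : ∃ q, q = b ⊓ g (point (m, (0, 1))) := ⟨_, rfl⟩
    have hqq : q * q ≤ 1 ⊔ q := by
      rw [hq, sup_inf_left, hb, ← h.map_point_mul_self h3', ← g.map_point_mul_self h3']
      exact le_inf (mul_mono inf_le_left inf_le_left) (mul_mono inf_le_right inf_le_right)
    have hqb : q * (b \ q) = ⊥ := by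
      have hqle : q ≤ b := hq ▸ inf_le_left
      subst hb
      have d : (0, 1) ≠ (0 : ZMod 3 × ZMod 3) ∧ (1, 0) ≠ (0 : ZMod 3 × ZMod 3) ∧
          (1, 0) ≠ ((0, 1) : ZMod 3 × ZMod 3) ∧ (1, 0) ≠ (-(0, 1) : ZMod 3 × ZMod 3) := by decide
      exact h.mul_sdiff_eq_bot (x := (0, (1, 0))) h3' (fun h => d.1 (congrArg Prod.snd h))
        (fun h => d.2.1 (congrArg Prod.snd h)) (fun h => d.2.2.1 (congrArg Prod.snd h))
        (fun h => d.2.2.2 (congrArg Prod.snd h)) hqle hqq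
    have hprod : (h (point (0, (1, 0))) ⊓ g (point (n, (1, 0)))) * q ≤
        g (point (n + m, (1, 1))) ⊔ g (point (n - m, (1, -1))) := by
      have := g.map_point_mul (n, (1, 0)) (m, (0, 1))
      simp only [Prod.mk_add_mk, Prod.mk_sub_mk, add_zero, zero_add, sub_zero, zero_sub] at this
      rw [← this, hq]
      exact mul_mono inf_le_right inf_le_right
    have hsum : h (point (0, (1, 0))) ≤ b * h (point (0, (1, 1))) := by
      rw [hb, h.map_point_mul, ← point_neg ((0, (0, 1)) - (0, (1, 1)))]
      refine le_of_eq_of_le (congrArg (fun v => h (point v)) ?_) le_sup_right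
      ext <;> simp
    have hsub : h (point (0, (1, 0))) ≤ b * h (point (0, (1, -1))) := by
      rw [hb, h.map_point_mul]
      refine le_of_eq_of_le (congrArg (fun v => h (point v)) ?_) le_sup_left
      ext <;> simp
    rw [← hb, ← hq]
    -- One of the two points of the product of `(0, (1, 0))` and `(0, (0, 1))` is missed, which makes
    -- the product of the two parts vanish.
    by_cases h1 : n + m ∈ N (1, 1)
    · have h2 : n - m ∉ N (1, -1) := fun h2 => hn0 (hN.rigid n m hn hm h1 h2)
      refine mul_eq_bot_of_disjoint (s := h (point (0, (1, -1)))) (hq ▸ inf_le_left) hqb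
        (inf_le_left.trans hsub) (Disjoint.mono hprod (hfib _) ?_)
      rw [disjoint_sup_left]
      exact ⟨g.disjoint_point fun hm => ne.1 (mem_fibre_zero hm).2,
        g.disjoint_point fun hm => h2 (mem_fibre_zero hm).1⟩
    · refine mul_eq_bot_of_disjoint (s := h (point (0, (1, 1)))) (hq ▸ inf_le_left) hqb
        (inf_le_left.trans hsum) (Disjoint.mono hprod (hfib _) ?_)
      rw [disjoint_sup_left]
      exact ⟨g.disjoint_point fun hm => h1 (mem_fibre_zero hm).1,
        g.disjoint_point fun hm => ne.2 (mem_fibre_zero hm).2⟩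
  have core' : ∀ n ∈ N (1, 0), n ≠ 0 →
      Disjoint (h (point (0, (1, 0)))) (g (point (n, (1, 0)))) := by
    intro n hn hn0
    rw [disjoint_iff]
    obtain ⟨p, hp⟩ : ∃ p, p = h (point (0, (1, 0))) ⊓ g (point (n, (1, 0))) := ⟨_, rfl⟩
    rw [← hp]
    refine eq_bot_of_mul_eq_bot (b := h (point (0, (0, 1)))) (c := h (point (0, (0, 1))))
      (by rw [h.map_point_mul_self h3']; exact le_sup_left) ?_
    have key : h (point (0, (0, 1))) ⊓ p * ⊤ = ⊥ := by
      refine g.eq_bot_of_disjoint_points fun v => ?_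
      by_cases hv : v ∈ (fibre N (0, (0, 1))).1
      · obtain ⟨m, hm, hmv⟩ : ∃ m ∈ N (0, 1), point v = point (m, (0, 1)) :=
          exists_point_eq_of_mem_fibre hv
        have := core n m hn hm hn0
        rw [← hp] at this
        rw [hmv, disjoint_iff, inf_right_comm, ← disjoint_iff, ← disjoint_mul_comm, this]
        exact disjoint_bot_left
      · exact ((g.disjoint_point hv).symm.mono_left (hfib _)).mono_left inf_le_left
    rw [← disjoint_iff, ← disjoint_mul_comm, disjoint_top] at key
    exact key
  refine g.le_of_disjoint_points fun v hv => ?_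
  by_cases hv' : v ∈ (fibre N (0, (1, 0))).1
  · obtain ⟨n, hn, hnv⟩ : ∃ n ∈ N (1, 0), point v = point (n, (1, 0)) :=
      exists_point_eq_of_mem_fibre hv'
    rw [hnv]
    refine core' n hn ?_
    rintro rfl
    exact hv (hnv ▸ Or.inl rfl)
  · exact (g.disjoint_point hv').symm.mono_left (hfib _)

end Epi

namespace RelTypeAlg

/-- A homomorphism from the algebra of symmetric sets to a symmetric relation algebra. -/
def Hom.toSymmSetHom {G : Type u} [AddCommGroup G] {C : RelTypeAlg.{u}} (hC : C ∈ symmetricRA)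
    (k : Hom (symmSetAlg G) C) : letI := symmetricRelAlg hC; SymmSetHom G C.carrier :=
  letI := symmetricRelAlg hC
  { toFun := k.toFun
    map_union := k.map_join
    map_compl := k.map_neg
    map_sum := k.map_comp
    map_zero := k.map_t }

variable {W : Type u} [AddCommGroup W] {N : ZMod 3 × ZMod 3 → AddSubgroup W}

theorem isEpi_incl_saturated [Finite W] (hN : IsRigidFamily N) (h3 : ∀ w : W, w + w = -w) :
    (isSubuniverse_saturated hN).incl.IsEpi symmetricRA := by
  intro C hC g h hgh
  let := symmetricRelAlg hC
  have agree : ∀ X ∈ saturated N, h.toFun X = g.toFun X := fun X hX =>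
    (congrArg (fun k : Hom (isSubuniverse_saturated hN).alg C => k.toFun ⟨X, hX⟩) hgh).symm
  have h1 : h.toFun (point (0, (1, 0))) = g.toFun (point (0, (1, 0))) := le_antisymm
    (map_point_one_zero_le hN h3 (h.toSymmSetHom hC) (g.toSymmSetHom hC) agree)
    (map_point_one_zero_le hN h3 (g.toSymmSetHom hC) (h.toSymmSetHom hC)
      fun X hX => (agree X hX).symm)
  have h2 : ∀ v, h.toFun (point v) = g.toFun (point v) :=
    point_mem_of_point_one_zero_mem hN h3 (isSubuniverse_eqLocus g h) agree h1
  refine Hom.ext fun X => le_antisymm ?_ ?_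
  · exact SymmSetHom.le_of_point_eq (g.toSymmSetHom hC) (h.toSymmSetHom hC)
      (fun v => (h2 v).symm) X
  · exact SymmSetHom.le_of_point_eq (h.toSymmSetHom hC) (g.toSymmSetHom hC) h2 X

theorem not_surjective_incl_saturated (hN : IsRigidFamily N) :
    ¬ Function.Surjective (isSubuniverse_saturated hN).incl.toFun := by
  intro hsurj
  obtain ⟨X, hX⟩ := hsurj (point (0, (1, 0)))
  have hmem : point (0, (1, 0)) ∈ saturated N := hX ▸ X.2
  obtain ⟨n, hn, hn0⟩ := (N (1, 0)).bot_or_exists_ne_zero.resolve_left hN.ne_bot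
  rcases hmem _ (Or.inl rfl) n hn with h | h
  · exact hn0 (by simpa using congrArg Prod.fst h)
  · exact (by decide : (1, 0) ≠ (-(1, 0) : ZMod 3 × ZMod 3)) (congrArg Prod.snd h)

/-! ### A rigid family of subgroups -/

section Family

variable {K : Type u} [Field K]

/-- Direction vectors of the lines through the origin of the plane over `K` with slopes `0`, `∞`, `1`
and `γ`, attached to `±(1, 0)`, `±(0, 1)`, `±(1, 1)` and `±(1, -1)`; the value at `0` is not used. -/
def direction (γ : K) (e : ZMod 3 × ZMod 3) : K × K :=
  if e.1 = 0 then (0, 1) else (1, if e.2 = 0 then 0 else if e.1 = e.2 then 1 else γ)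

theorem direction_neg (γ : K) (e : ZMod 3 × ZMod 3) : direction γ (-e) = direction γ e := by
  simp [direction]

theorem det_direction_ne_zero {γ : K} (h0 : γ ≠ 0) (h1 : γ ≠ 1) {e e' : ZMod 3 × ZMod 3}
    (he : e ≠ 0) (he' : e' ≠ 0) (h : e' ≠ e) (h' : e' ≠ -e) :
    (direction γ e).1 * (direction γ e').2 - (direction γ e).2 * (direction γ e').1 ≠ 0 := by
  have key1 : ∀ e e' : ZMod 3 × ZMod 3, e ≠ 0 → e' ≠ 0 → e.1 = 0 → e'.1 = 0 →
      e' = e ∨ e' = -e := by decide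
  have key2 : ∀ e e' : ZMod 3 × ZMod 3, e.1 ≠ 0 → e'.1 ≠ 0 → (e.2 = 0 ↔ e'.2 = 0) →
      (e.1 = e.2 ↔ e'.1 = e'.2) → e' = e ∨ e' = -e := by decide
  have slope : ∀ e : ZMod 3 × ZMod 3, e.1 ≠ 0 → e.2 = 0 → e.1 ≠ e.2 := by decide
  have not_key : ¬ (e' = e ∨ e' = -e) := not_or.mpr ⟨h, h'⟩
  unfold direction
  by_cases hs : e.1 = 0 <;> by_cases hs' : e'.1 = 0
  · exact absurd (key1 e e' he he' hs hs') not_key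
  · simp [hs, hs']
  · simp [hs, hs']
  · simp only [hs, hs', if_false, one_mul, mul_one]
    rw [sub_ne_zero]
    have := slope e hs
    have := slope e' hs'
    have := key2 e e' hs hs'
    split_ifs <;> simp_all [eq_comm]

/-- The lines spanned by `direction γ`, as additive subgroups, with the trivial subgroup at `0`. -/
def lineFamily (γ : K) (e : ZMod 3 × ZMod 3) : AddSubgroup (K × K) where
  carrier := {w | (e = 0 → w = 0) ∧ (direction γ e).1 * w.2 = (direction γ e).2 * w.1}
  zero_mem' := by simp
  add_mem' := by
    rintro v w ⟨h1, h2⟩ ⟨h3, h4⟩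
    refine ⟨fun h => by rw [h1 h, h3 h, add_zero], ?_⟩
    rw [Prod.snd_add, Prod.fst_add, mul_add, mul_add, h2, h4]
  neg_mem' := by
    rintro w ⟨h1, h2⟩
    refine ⟨fun h => by rw [h1 h, neg_zero], ?_⟩
    rw [Prod.snd_neg, Prod.fst_neg, mul_neg, mul_neg, h2]

theorem mem_lineFamily {γ : K} {e : ZMod 3 × ZMod 3} {w : K × K} :
    w ∈ lineFamily γ e ↔
      (e = 0 → w = 0) ∧ (direction γ e).1 * w.2 = (direction γ e).2 * w.1 := Iff.rfl

theorem smul_direction_mem {γ : K} {e : ZMod 3 × ZMod 3} (he : e ≠ 0) (c : K) :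
    c • direction γ e ∈ lineFamily γ e := by
  refine ⟨fun h => absurd h he, ?_⟩
  simp only [Prod.smul_fst, Prod.smul_snd, smul_eq_mul]
  ring

theorem lineFamily_neg (γ : K) (e : ZMod 3 × ZMod 3) : lineFamily γ (-e) = lineFamily γ e := by
  ext w
  rw [mem_lineFamily, mem_lineFamily, direction_neg, neg_eq_zero]

theorem lineFamily_zero (γ : K) : lineFamily γ 0 = ⊥ := by
  ext w
  rw [mem_lineFamily, AddSubgroup.mem_bot]
  exact ⟨fun h => h.1 rfl, fun h => by simp [h]⟩

/-- Four lines with distinct slopes form a rigid family as soon as their cross ratio `γ` is not in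
the prime field. -/
theorem isRigidFamily_lineFamily {γ : K} (h0 : γ ≠ 0) (h1 : γ ≠ 1) (h2 : γ ≠ -1) :
    IsRigidFamily (lineFamily γ) where
  zero := lineFamily_zero γ
  neg := lineFamily_neg γ
  add_le e e' := by
    by_cases he : e = 0
    · rw [he, zero_add]
      exact le_sup_right
    by_cases he' : e' = 0
    · rw [he', add_zero]
      exact le_sup_left
    by_cases h : e' = e
    · have : ∀ e : ZMod 3 × ZMod 3, e + e = -e := by decide
      rw [h, this, lineFamily_neg]
      exact le_sup_left
    by_cases h' : e' = -e
    · rw [h', add_neg_cancel, lineFamily_zero]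
      exact bot_le
    -- Two distinct lines span the plane; the coefficients are given by Cramer's rule.
    have hdet := det_direction_ne_zero h0 h1 he he' h h'
    intro w _
    refine AddSubgroup.mem_sup.mpr ⟨_, smul_direction_mem he
      ((w.1 * (direction γ e').2 - w.2 * (direction γ e').1) /
        ((direction γ e).1 * (direction γ e').2 - (direction γ e).2 * (direction γ e').1)), _,
      smul_direction_mem he' ((w.2 * (direction γ e).1 - w.1 * (direction γ e).2) /
        ((direction γ e).1 * (direction γ e').2 - (direction γ e).2 * (direction γ e').1)), ?_⟩
    ext
    · simp only [Prod.fst_add, Prod.smul_fst, smul_eq_mul]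
      rw [div_mul_eq_mul_div, div_mul_eq_mul_div, ← add_div, div_eq_iff hdet]
      ring
    · simp only [Prod.snd_add, Prod.smul_snd, smul_eq_mul]
      rw [div_mul_eq_mul_div, div_mul_eq_mul_div, ← add_div, div_eq_iff hdet]
      ring
  ne_top e he htop := by
    by_cases hs : e.1 = 0
    · have : ((1, 0) : K × K) ∈ lineFamily γ e := htop ▸ AddSubgroup.mem_top _
      simp [mem_lineFamily, direction, hs] at this
    · have : ((0, 1) : K × K) ∈ lineFamily γ e := htop ▸ AddSubgroup.mem_top _
      simp [mem_lineFamily, direction, hs] at this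
  ne_bot h := by
    have : ((1, 0) : K × K) ∈ lineFamily γ (1, 0) := by simp [mem_lineFamily, direction]
    rw [h, AddSubgroup.mem_bot] at this
    simp at this
  inf_add := by
    rintro ⟨x, y⟩ h3 h4
    simp_all [mem_lineFamily, direction]
  inf_sub := by
    rintro ⟨x, y⟩ h3 h4
    have ne : (1 : ZMod 3) ≠ -1 := by decide
    simp only [mem_lineFamily, direction] at h3 h4
    simp [ne] at h3 h4
    rw [h4, ← h3, mul_zero]
    rfl
  rigid := by
    rintro ⟨x, y⟩ ⟨x', y'⟩ h3 h4 h5 h6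
    have ne : (1 : ZMod 3) ≠ -1 := by decide
    simp only [mem_lineFamily, direction] at h3 h4 h5 h6
    simp [ne] at h3 h4 h5 h6
    subst h3 h4
    rw [zero_add, add_zero] at h5
    have h7 : (γ + 1) * x = 0 := by
      rw [zero_sub, sub_zero, h5] at h6
      linear_combination -h6
    have h8 : γ + 1 ≠ 0 := fun h => h2 (eq_neg_of_add_eq_zero_left h)
    rw [(mul_eq_zero.mp h7).resolve_left h8]
    rfl

end Family
end RelTypeAlg

open RelTypeAlg

namespace RelTypeAlg

/-- There are dense symmetric relation algebras with a proper inclusion that is an epimorphism even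
among all abelian relation algebras. -/
theorem exists_isEpi_not_surjective :
    ∃ A ∈ denseSymmetricRA.{u}, ∃ B ∈ denseSymmetricRA.{u}, ∃ f : Hom A B,
      f.IsEpi abelianRA ∧ ¬ Function.Surjective f.toFun := by
  let K := ULift.{u} (GaloisField 3 2)
  have : Finite K := inferInstance
  have h3 : ∀ x : K, x + x = -x := fun x => by
    have h : (3 : GaloisField 3 2) = 0 := CharP.cast_eq_zero (GaloisField 3 2) 3
    refine ULift.ext _ _ ?_
    change x.down + x.down = -x.down
    linear_combination x.down * h
  obtain ⟨γ, h0, h1, h2⟩ : ∃ γ : K, γ ≠ 0 ∧ γ ≠ 1 ∧ γ ≠ -1 := by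
    by_contra! hcon
    have hcard : Nat.card K = 9 := by
      rw [Nat.card_congr Equiv.ulift, GaloisField.card 3 2 two_ne_zero]
      norm_num
    have hsub : (Set.univ : Set K) ⊆ {0, 1, -1} := fun γ _ => by
      by_cases h0 : γ = 0
      · exact Or.inl h0
      by_cases h1 : γ = 1
      · exact Or.inr (Or.inl h1)
      · exact Or.inr (Or.inr (hcon γ h0 h1))
    have := Set.ncard_le_ncard hsub
    rw [Set.ncard_univ, hcard] at this
    have h4 := Set.ncard_insert_le (0 : K) {1, -1}
    have h5 := Set.ncard_insert_le (1 : K) {-1}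
    have h6 := Set.ncard_singleton (-1 : K)
    omega
  have hN := isRigidFamily_lineFamily h0 h1 h2
  have hW : ∀ w : K × K, w + w = -w := fun w => Prod.ext (h3 w.1) (h3 w.2)
  have hB : symmSetAlg ((K × K) × (ZMod 3 × ZMod 3)) ∈ denseSymmetricRA :=
    symmSetAlg_mem_denseSymmetricRA fun v =>
      Prod.ext (hW v.1) ((by decide : ∀ e : ZMod 3 × ZMod 3, e + e = -e) v.2)
  have hS := isSubuniverse_saturated hN
  exact ⟨hS.alg, denseSymmetricRA_of_injective hB hS.incl hS.incl_injective, _, hB, hS.incl,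
    Hom.isEpi_abelianRA_of_symmetricRA hB.2.2 (isEpi_incl_saturated hN hW),
    not_surjective_incl_saturated hN⟩

theorem not_ES_of_subset {V : Set RelTypeAlg.{u}} (h1 : denseSymmetricRA ⊆ V)
    (h2 : V ⊆ abelianRA) : ¬ ES V := by
  obtain ⟨A, hA, B, hB, f, hf, hsurj⟩ := exists_isEpi_not_surjective.{u}
  exact fun hES => hsurj (hES A (h1 hA) B (h1 hB) f (hf.anti h2))

end RelTypeAlg

theorem mainTheorem4 :
    ∀ V ∈ ({RelTypeAlg.abelianRA, RelTypeAlg.symmetricRA, RelTypeAlg.denseSymmetricRA} :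
        Set (Set RelTypeAlg.{u})),
      ¬ RelTypeAlg.ES V ∧
      (∀ (L : Type u) [Lattice L] [OrderBot L] [IsModularLattice L],
        RelTypeAlg.latticeComplexAlg L ∈ V) ∧
      RelTypeAlg.latticeRA ⊆ V ∧
      V ⊆ RelTypeAlg.abelianRA := by
  have key : ∀ V : Set RelTypeAlg.{u}, denseSymmetricRA ⊆ V → V ⊆ abelianRA →
      ¬ ES V ∧ (∀ (L : Type u) [Lattice L] [OrderBot L] [IsModularLattice L],
        latticeComplexAlg L ∈ V) ∧ latticeRA ⊆ V ∧ V ⊆ abelianRA := fun V h1 h2 =>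
    ⟨not_ES_of_subset h1 h2, fun L _ _ _ => h1 (latticeComplexAlg_mem_denseSymmetricRA L),
      latticeRA_subset_denseSymmetricRA.trans h1, h2⟩
  have hds := denseSymmetricRA_subset_symmetricRA.{u}
  have hsa := symmetricRA_subset_abelianRA.{u}
  rintro V (rfl | rfl | rfl)
  · exact key _ (hds.trans hsa) subset_rfl
  · exact key _ hds hsa
  · exact key _ subset_rfl (hds.trans hsa)
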